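/- Let $n\ge 1$ and $1\le q\le r<p<\infty$. A cube is a half-open cube $Q=\prod_{i=1}^n[a_i,a_i+h)\subset\mathbb R^n$, $h>0$, and $3Q$ is the concentric cube with side $3h$. Functions are real- or complex-valued. Let $T$ be a sublinear operator from $L^q(\mathbb R^n)+L^r(\mathbb R^n)$ to measurable functions, that is, $|T(f+g)|\le|Tf|+|Tg|$ and $|T(cf)|=|c||Tf|$ almost everywhere for all $f,g$ in the domain and all scalars $c$. Define $$\mathcal M_Tf(x)=\sup_{Q\ni x}\ \operatorname*{ess\,sup}_{\xi\in Q}\,|T(f\chi_{\mathbb R^n\setminus 3Q})(\xi)|,$$ the supremum being over all cubes $Q$ containing $x$. For $1\le s<\infty$ let $\|S\|_{L^s\to L^{s,\infty}}$ be the least $A\in[0,\infty]$ such that $t\,|\{x:|Sf(x)|>t\}|^{1/s}\le A\|f\|_{L^s}$ for all $f\in L^s(\mathbb R^n)$ and $t>0$; $S$ is of weak type $(s,s)$ if this is finite. A weight is a non-negative locally integrable function $w$ on $\mathbb R^n$; $L^p(w)$ is the $L^p$ space of the measure $w\,dx$; and for $1<s<\infty$, $w\in A_s$ means $$[w]_{A_s}=\sup_Q\Big(\frac1{|Q|}\int_Qw\,dx\Big)\Big(\frac1{|Q|}\int_Qw^{-\frac1{s-1}}\,dx\Big)^{s-1}<\infty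 ,$$ where $w^{-1/(s-1)}=\infty$ at points where $w=0$, and $0\cdot\infty=0$. There is a constant $c_{n,p,q,r}<\infty$, depending only on $n,p,q,r$, such that the following holds. Assume that $T$ is of weak type $(q,q)$ and $\mathcal M_T$ is of weak type $(r,r)$. Then for every weight $w\in A_{p/r}$ the operator $T$ is bounded on $L^p(w)$, with $$\|T\|_{L^p(w)}\le C\,[w]_{A_{p/r}}^{\max\left(1,\frac1{p-r}\right)},\qquad C=c_{n,p,q,r}\big(\|T\|_{L^q\to L^{q,\infty}}+\|\mathcal M_T\|_{L^r\to L^{r,\infty}}\big).$$ That is, $\|Tf\|_{L^p(w)}\le C\,[w]_{A_{p/r}}^{\max(1,1/(p-r))}\|f\|_{L^p(w)}$ for every $f\in(L^q+L^r)\cap L^p(w)$, and the restriction of $T$ to $(L^q+L^r)\cap L^p(w)$ extends to a sublinear operator on all of $L^p(w)$ (a linear one if $T$ is linear) that satisfies the same inequality for every $f\in L^p(w)$. -/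

import Mathlib

open MeasureTheory Set
open scoped ENNReal NNReal

/-- The half-open cube `∏ i, [a i, a i + h)` in `ℝⁿ`; it is a genuine cube when `0 < h`. -/
def cube {n : ℕ} (a : Fin n → ℝ) (h : ℝ) : Set (Fin n → ℝ) :=
  Set.pi Set.univ fun i => Set.Ico (a i) (a i + h)

/-- `3Q` for `Q = cube a h`: the cube with the same centre as `Q` and three times its side. -/
def tripleCube {n : ℕ} (a : Fin n → ℝ) (h : ℝ) : Set (Fin n → ℝ) :=
  cube (fun i => a i - h) (3 * h)

/-- The (representatives of) functions in `L^q(ℝⁿ) + L^r(ℝⁿ)`. It contains `L^q` and `L^r`, and is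
the natural domain of an operator acting on both. -/
def sumLp {n : ℕ} (𝕜 : Type) [RCLike 𝕜] (q r : ℝ) : Set ((Fin n → ℝ) → 𝕜) :=
  {f | ∃ g h : (Fin n → ℝ) → 𝕜,
    MemLp g (ENNReal.ofReal q) volume ∧ MemLp h (ENNReal.ofReal r) volume ∧ f = g + h}

/-- `T` is a sublinear operator from the class `D` of functions to measurable functions:
it respects equality almost everywhere, `|T(f + g)| ≤ |Tf| + |Tg|` and `|T(c f)| = |c| |Tf|`. The
values of `T` outside `D` are irrelevant. -/
structure IsSublinearOn {n : ℕ} {𝕜 : Type} [RCLike 𝕜] (μ : Measure (Fin n → ℝ))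
    (D : Set ((Fin n → ℝ) → 𝕜)) (T : ((Fin n → ℝ) → 𝕜) → ((Fin n → ℝ) → 𝕜)) : Prop where
  aestronglyMeasurable : ∀ f ∈ D, AEStronglyMeasurable (T f) μ
  congr_ae : ∀ f ∈ D, ∀ g ∈ D, f =ᵐ[μ] g → T f =ᵐ[μ] T g
  norm_add_le : ∀ f ∈ D, ∀ g ∈ D, ∀ᵐ x ∂μ, ‖T (f + g) x‖ ≤ ‖T f x‖ + ‖T g x‖
  norm_smul : ∀ (c : 𝕜), ∀ f ∈ D, ∀ᵐ x ∂μ, ‖T (c • f) x‖ = ‖c‖ * ‖T f x‖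

/-- `T` is linear on the class `D` of functions, up to equality almost everywhere. -/
structure IsLinearOn {n : ℕ} {𝕜 : Type} [RCLike 𝕜] (μ : Measure (Fin n → ℝ))
    (D : Set ((Fin n → ℝ) → 𝕜)) (T : ((Fin n → ℝ) → 𝕜) → ((Fin n → ℝ) → 𝕜)) : Prop where
  map_add : ∀ f ∈ D, ∀ g ∈ D, T (f + g) =ᵐ[μ] T f + T g
  map_smul : ∀ (c : 𝕜), ∀ f ∈ D, T (c • f) =ᵐ[μ] c • T f

/-- The quasi-norm `‖S‖_{L^q → L^{q,∞}}`: the least `A ∈ [0, ∞]` with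
`t |{x : S f (x) > t}|^{1/q} ≤ A ‖f‖_q` for all `f ∈ L^q` and `t ≥ 0`. The operator enters through
its absolute value, a function with values in `[0, ∞]`. -/
noncomputable def weakNorm {n : ℕ} {𝕜 : Type} [RCLike 𝕜] (q : ℝ)
    (S : ((Fin n → ℝ) → 𝕜) → (Fin n → ℝ) → ℝ≥0∞) : ℝ≥0∞ :=
  sInf {A | ∀ f : (Fin n → ℝ) → 𝕜, MemLp f (ENNReal.ofReal q) volume → ∀ t : ℝ≥0,
    (t : ℝ≥0∞) * volume {x | (t : ℝ≥0∞) < S f x} ^ (1 / q) ≤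
      A * eLpNorm f (ENNReal.ofReal q) volume}

/-- `S` is of weak type `(q, q)`. -/
def IsWeakType {n : ℕ} {𝕜 : Type} [RCLike 𝕜] (q : ℝ)
    (S : ((Fin n → ℝ) → 𝕜) → (Fin n → ℝ) → ℝ≥0∞) : Prop :=
  weakNorm q S < ⊤

/-- `|Tf|` as a function with values in `[0, ∞]`. -/
noncomputable def absOp {n : ℕ} {𝕜 : Type} [RCLike 𝕜]
    (T : ((Fin n → ℝ) → 𝕜) → ((Fin n → ℝ) → 𝕜)) :
    ((Fin n → ℝ) → 𝕜) → (Fin n → ℝ) → ℝ≥0∞ :=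
  fun f x => ‖T f x‖ₑ

/-- The grand maximal truncated operator
`M_T f (x) = sup_{Q ∋ x} ess sup_{ξ ∈ Q} |T(f χ_{ℝⁿ ∖ 3Q})(ξ)|`. -/
noncomputable def grandMax {n : ℕ} {𝕜 : Type} [RCLike 𝕜]
    (T : ((Fin n → ℝ) → 𝕜) → ((Fin n → ℝ) → 𝕜)) :
    ((Fin n → ℝ) → 𝕜) → (Fin n → ℝ) → ℝ≥0∞ :=
  fun f x => ⨆ (a : Fin n → ℝ) (h : ℝ) (_ : 0 < h) (_ : x ∈ cube a h),
    essSup (fun ξ => ‖T ((tripleCube a h)ᶜ.indicator f) ξ‖ₑ) (volume.restrict (cube a h))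

/-- A weight: a non-negative locally integrable function. -/
structure IsWeight {n : ℕ} (w : (Fin n → ℝ) → ℝ) : Prop where
  nonneg : ∀ x, 0 ≤ w x
  locallyIntegrable : LocallyIntegrable w volume

/-- The measure `w dx`, so that `L^p(w)` is `L^p` of this measure. -/
noncomputable def weightMeasure {n : ℕ} (w : (Fin n → ℝ) → ℝ) : Measure (Fin n → ℝ) :=
  volume.withDensity fun x => ENNReal.ofReal (w x)

/-- The constant `[w]_{A_s} = sup_Q (|Q|⁻¹ ∫_Q w) (|Q|⁻¹ ∫_Q w^{-1/(s-1)})^{s-1} ∈ [0, ∞]`,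
for `1 < s < ∞`. Here `w^{-1/(s-1)} = ∞` where `w = 0`. -/
noncomputable def apConst {n : ℕ} (s : ℝ) (w : (Fin n → ℝ) → ℝ) : ℝ≥0∞ :=
  ⨆ (a : Fin n → ℝ) (h : ℝ) (_ : 0 < h),
    ((volume (cube a h))⁻¹ * ∫⁻ x in cube a h, ENNReal.ofReal (w x)) *
      ((volume (cube a h))⁻¹ *
        ∫⁻ x in cube a h, ENNReal.ofReal (w x) ^ (-(1 / (s - 1)))) ^ (s - 1)

/-! The operator is dominated pointwise by sparse sums through a local stopping-time argument, and
sparse sums obey the sharp weighted bound.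

Domination (`exists_sparse_domination`). Let N be the sum of the two weak norms and λ_Q a
dimensional multiple of N times the L^r average of f over 3Q. By weak type, |T(f χ_{3Q})| and M_T(f
χ_{3Q}) are at most λ_Q off an open set U with |U| ≤ 2^{-(n+2)}|Q|. The maximal dyadic P ⊂ Q in
which U has density above 2^{-(n+1)} cover U ∩ Q and fill at most half of Q, yet each contains a
point outside U. At that point M_T controls T(f χ_{3Q∖3P}) essentially on P, so |T(f χ_{3Q})| ≤ λ_Q
+ |T(f χ_{3P})| a.e. on P. Iteration gives |T(f χ_{3Q₀})| ≤ ∑ λ_Q χ_Q a.e. on Q₀ over the selected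
cubes. The parts E_Q of these cubes outside their stopping children are disjoint and |Q| ≤ 2|E_Q|.

Weighted bound (`lintegral_sparse_sum_rpow_le`). Let G be a finite sparse sum and σ =
w^{-1/(p/r-1)}. Then ∫ G^p w = ∑ λ_Q ∫_Q G^{p-1} w. Each summand is expressed by the σ-average of
|f|^r/σ over 3Q and the w-average of G^{p-1} over Q. The A_{p/r} condition replaces the masses of 3Q
and Q by those of E_Q, and this is where the power of [w] arises (`two_weight_testing`). Hölder's
inequality and two Carleson embeddings (`carleson_embedding_of_laminar`), with constants independent
of the weight, finish the estimate. The triples 3Q are split into 3^n laminar colour classes for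
this purpose.

Globalisation. The bound on a cube does not depend on the cube. The error of truncating f tends to
zero almost everywhere along a subsequence, and Fatou's lemma yields the bound for f
(`eLpNorm_le_of_forall_truncation`). The operator then extends to L^p(w) by continuity
(`IsSublinearOn.exists_extension`). -/

/-! ### Laminar families and the Carleson embedding. -/

/-- A finite laminar family whose members satisfy `t μ(R) ≤ ν(R)` satisfies it for the union. -/
theorem mul_measure_biUnion_le_of_laminar {α ι : Type*} [MeasurableSpace α] {μ ν : Measure α}
    (R : ι → Set α) (t : ℝ≥0∞) (s : Finset ι) (hm : ∀ i ∈ s, MeasurableSet (R i))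
    (hlam : ∀ i ∈ s, ∀ j ∈ s, R i ⊆ R j ∨ R j ⊆ R i ∨ Disjoint (R i) (R j))
    (ht : ∀ i ∈ s, t * μ (R i) ≤ ν (R i)) :
    t * μ (⋃ i ∈ s, R i) ≤ ν (⋃ i ∈ s, R i) := by
  classical
  induction s using Finset.strongInduction with
  | H s ih =>
    rcases s.eq_empty_or_nonempty with rfl | ⟨i, hi⟩
    · simp
    -- Either `R i` lies in another member and can be dropped, or every other member lies inside it
    -- or is disjoint from it.
    by_cases hj : ∃ j ∈ s, j ≠ i ∧ R i ⊆ R j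
    · obtain ⟨j, hjs, hji, hij⟩ := hj
      have hU : (⋃ k ∈ s, R k) = ⋃ k ∈ s.erase i, R k := by
        apply subset_antisymm
        · refine iUnion₂_subset fun k hk => ?_
          by_cases hki : k = i
          · subst hki
            exact hij.trans (subset_biUnion_of_mem (u := R) (Finset.mem_coe.2
              (Finset.mem_erase.2 ⟨hji, hjs⟩)))
          · exact subset_biUnion_of_mem (u := R) (Finset.mem_coe.2 (Finset.mem_erase.2 ⟨hki, hk⟩))
        · exact biUnion_subset_biUnion_left (Finset.erase_subset i s)
      rw [hU]
      exact ih _ (Finset.erase_ssubset hi) (fun k hk => hm k (Finset.mem_of_mem_erase hk))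
        (fun k hk l hl => hlam k (Finset.mem_of_mem_erase hk) l (Finset.mem_of_mem_erase hl))
        (fun k hk => ht k (Finset.mem_of_mem_erase hk))
    · push Not at hj
      set u := (s.erase i).filter fun k => Disjoint (R i) (R k) with hu
      have hus : u ⊆ s.erase i := Finset.filter_subset _ _
      have hus' : u ⊆ s := hus.trans (Finset.erase_subset i s)
      have hU : (⋃ k ∈ s, R k) = R i ∪ ⋃ k ∈ u, R k := by
        apply subset_antisymm
        · refine iUnion₂_subset fun k hk => ?_
          by_cases hki : k = i
          · subst hki; exact subset_union_left
          rcases hlam i hi k hk with h | h | h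
          · exact absurd h (hj k hk hki)
          · exact h.trans subset_union_left
          · exact (subset_biUnion_of_mem (u := R) (Finset.mem_coe.2 (Finset.mem_filter.2
              ⟨Finset.mem_erase.2 ⟨hki, hk⟩, h⟩))).trans subset_union_right
        · exact union_subset (subset_biUnion_of_mem (u := R) (Finset.mem_coe.2 hi))
            (biUnion_subset_biUnion_left hus')
      have hd : Disjoint (R i) (⋃ k ∈ u, R k) := by
        simp only [disjoint_iUnion_right]
        exact fun k hk => (Finset.mem_filter.1 hk).2
      rw [hU, measure_union' hd (hm i hi) (μ := ν)]
      calc t * μ (R i ∪ ⋃ k ∈ u, R k) ≤ t * (μ (R i) + μ (⋃ k ∈ u, R k)) := by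
            gcongr; exact measure_union_le _ _
        _ = t * μ (R i) + t * μ (⋃ k ∈ u, R k) := mul_add _ _ _
        _ ≤ _ := add_le_add (ht i hi) (ih u (hus.trans_ssubset (Finset.erase_ssubset hi))
            (fun k hk => hm k (hus' hk)) (fun k hk l hl => hlam k (hus' hk) l (hus' hl))
            (fun k hk => ht k (hus' hk)))

/-- Absorption: X = X^{1/p} X^{1/p'}, and the finite factor X^{1/p'} is divided out. -/
theorem ENNReal.le_rpow_of_le_mul_rpow {a b X : ℝ≥0∞} {p p' : ℝ} (hpp : p.HolderConjugate p')
    (hX : X ≠ ⊤) (h : X ≤ a * b ^ (1 / p) * X ^ (1 / p')) : X ≤ a ^ p * b := by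
  rcases eq_or_ne X 0 with rfl | h0
  · simp
  have hX' : X = X ^ (1 / p) * X ^ (1 / p') := by
    rw [← ENNReal.rpow_add _ _ h0 hX, one_div, one_div, hpp.inv_add_inv_eq_one, ENNReal.rpow_one]
  have hne : X ^ (1 / p') ≠ 0 := by simp [h0, hX]
  have hnt : X ^ (1 / p') ≠ ⊤ := ENNReal.rpow_ne_top_of_nonneg hpp.symm.one_div_nonneg hX
  have h1 : X ^ (1 / p) ≤ a * b ^ (1 / p) := by
    refine (ENNReal.mul_le_mul_iff_left hne hnt).1 ?_
    rwa [← hX']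
  have h2 := ENNReal.rpow_le_rpow h1 hpp.nonneg
  rwa [ENNReal.mul_rpow_of_nonneg _ _ hpp.nonneg, ← ENNReal.rpow_mul, ← ENNReal.rpow_mul,
    one_div_mul_cancel hpp.ne_zero, ENNReal.rpow_one, ENNReal.rpow_one] at h2

/-- The Carleson embedding theorem for a finite laminar family, i.e. the `L^p` bound for the
maximal function of the family. -/
theorem carleson_embedding_of_laminar {α ι : Type*} [MeasurableSpace α] {μ : Measure α}
    {p : ℝ} (hp : 1 < p) (s : Finset ι) (R E : ι → Set α) (hR : ∀ i ∈ s, MeasurableSet (R i))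
    (hE : ∀ i ∈ s, MeasurableSet (E i)) (hER : ∀ i ∈ s, E i ⊆ R i)
    (hlam : ∀ i ∈ s, ∀ j ∈ s, R i ⊆ R j ∨ R j ⊆ R i ∨ Disjoint (R i) (R j))
    (hdis : (s : Set ι).PairwiseDisjoint E) (hfin : ∀ i ∈ s, μ (R i) ≠ ⊤)
    (c : ι → ℝ≥0) (F : α → ℝ≥0∞) (hF : AEMeasurable F μ)
    (hc : ∀ i ∈ s, c i * μ (R i) ≤ ∫⁻ x in R i, F x ∂μ) :
    ∑ i ∈ s, (c i : ℝ≥0∞) ^ p * μ (E i) ≤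
      ENNReal.ofReal (p / (p - 1)) ^ p * ∫⁻ x, F x ^ p ∂μ := by
  classical
  have hp0 : 0 < p := by linarith
  have hp1 : 0 < p - 1 := by linarith
  have hpp : p.HolderConjugate (p / (p - 1)) := Real.HolderConjugate.conjExponent hp
  set ν := μ.withDensity F with hν
  have hνR : ∀ i ∈ s, ν (R i) = ∫⁻ x in R i, F x ∂μ := fun i hi => withDensity_apply _ (hR i hi)
  -- The maximal function of the family. Its superlevel sets are unions of members, to which the
  -- laminar covering bound applies.
  set m : α → ℝ≥0 := fun x => s.sup fun i => (R i).indicator (fun _ => c i) x with hm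
  have hmm : Measurable m := by
    have h : m = s.sup fun i => (R i).indicator (fun _ => c i) := by
      ext x; rw [Finset.sup_apply]
    rw [h]
    exact Finset.sup_induction measurable_const (fun _ h₁ _ h₂ => h₁.sup h₂)
      fun i hi => measurable_const.indicator (hR i hi)
  have hset : ∀ t : ℝ, 0 < t →
      {x | t < (m x : ℝ)} = ⋃ i ∈ s.filter (fun i => t < (c i : ℝ)), R i := by
    intro t ht
    lift t to ℝ≥0 using ht.le
    ext x
    simp only [mem_ofPred_eq, NNReal.coe_lt_coe, hm, mem_iUnion, Finset.mem_filter, exists_prop]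
    rw [Finset.lt_sup_iff]
    refine exists_congr fun i => ?_
    by_cases hx : x ∈ R i <;> simp [hx]
  have hweak : ∀ t : ℝ, 0 < t →
      ENNReal.ofReal t * μ {x | t < (m x : ℝ)} ≤ ν {x | t < (m x : ℝ)} := by
    intro t ht
    rw [hset t ht]
    refine mul_measure_biUnion_le_of_laminar R _ _ (fun i hi => hR i (Finset.mem_filter.1 hi).1)
      (fun i hi j hj => hlam i (Finset.mem_filter.1 hi).1 j (Finset.mem_filter.1 hj).1)
      fun i hi => ?_
    obtain ⟨his, hti⟩ := Finset.mem_filter.1 hi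
    rw [hνR i his]
    refine le_trans ?_ (hc i his)
    gcongr
    exact ENNReal.ofReal_le_of_le_toReal hti.le
  have hcast : ∀ (x : α) (e : ℝ), 0 ≤ e → ENNReal.ofReal ((m x : ℝ) ^ e) = (m x : ℝ≥0∞) ^ e := by
    intro x e he
    rw [← NNReal.coe_rpow, ENNReal.ofReal_coe_nnreal, ENNReal.coe_rpow_of_nonneg _ he]
  set X := ∫⁻ x, (m x : ℝ≥0∞) ^ p ∂μ with hXdef
  have hX1 : X = ENNReal.ofReal p *
      ∫⁻ t in Ioi (0 : ℝ), μ {x | t < (m x : ℝ)} * ENNReal.ofReal (t ^ (p - 1)) := by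
    refine Eq.trans (lintegral_congr fun x => (hcast x p hp0.le).symm) ?_
    exact lintegral_rpow_eq_lintegral_meas_lt_mul μ (ae_of_all _ fun x => (m x).2)
      hmm.coe_nnreal_real.aemeasurable hp0
  have hY1 : ∫⁻ x, (m x : ℝ≥0∞) ^ (p - 1) ∂ν = ENNReal.ofReal (p - 1) *
      ∫⁻ t in Ioi (0 : ℝ), ν {x | t < (m x : ℝ)} * ENNReal.ofReal (t ^ (p - 1 - 1)) := by
    refine Eq.trans (lintegral_congr fun x => (hcast x _ hp1.le).symm) ?_
    exact lintegral_rpow_eq_lintegral_meas_lt_mul ν (ae_of_all _ fun x => (m x).2)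
      hmm.coe_nnreal_real.aemeasurable hp1
  -- Doob's argument: in the layer-cake formula for ∫ m^p dμ, one factor t turns μ into ν = F μ.
  have hcomp : X ≤ ENNReal.ofReal (p / (p - 1)) * ∫⁻ x, (m x : ℝ≥0∞) ^ (p - 1) ∂ν := by
    rw [hX1, hY1, ← mul_assoc, ← ENNReal.ofReal_mul (by positivity), div_mul_cancel₀ _ hp1.ne']
    gcongr ENNReal.ofReal p * ?_
    refine setLIntegral_mono' measurableSet_Ioi fun t ht => ?_
    have ht : 0 < t := ht
    calc μ {x | t < (m x : ℝ)} * ENNReal.ofReal (t ^ (p - 1))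
        = (ENNReal.ofReal t * μ {x | t < (m x : ℝ)}) * ENNReal.ofReal (t ^ (p - 1 - 1)) := by
          rw [Real.rpow_sub_one ht.ne' (p - 1), mul_right_comm, ← ENNReal.ofReal_mul ht.le,
            mul_div_cancel₀ _ ht.ne', mul_comm]
      _ ≤ _ := by gcongr; exact hweak t ht
  have hY2 : ∫⁻ x, (m x : ℝ≥0∞) ^ (p - 1) ∂ν ≤
      (∫⁻ x, F x ^ p ∂μ) ^ (1 / p) * X ^ (1 / (p / (p - 1))) := by
    have hmeas : AEMeasurable (fun x => (m x : ℝ≥0∞) ^ (p - 1)) μ :=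
      (hmm.coe_nnreal_ennreal.pow_const _).aemeasurable
    rw [hν, lintegral_withDensity_eq_lintegral_mul₀ hF hmeas]
    refine (ENNReal.lintegral_mul_le_Lp_mul_Lq μ hpp hF hmeas).trans_eq ?_
    congr 2
    refine lintegral_congr fun x => ?_
    rw [← ENNReal.rpow_mul, mul_div_cancel₀ _ hp1.ne']
  -- Finiteness is what permits absorption; `m` is bounded and supported on a set of finite measure.
  have hXfin : X ≠ ⊤ := by
    have hle : ∀ x, (m x : ℝ≥0∞) ^ p ≤
        (⋃ i ∈ s, R i).indicator (fun _ => ((s.sup c : ℝ≥0) : ℝ≥0∞) ^ p) x := by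
      intro x
      by_cases hx : x ∈ ⋃ i ∈ s, R i
      · rw [indicator_of_mem hx]
        gcongr
        simp only [hm]
        refine Finset.sup_mono_fun fun i _ => ?_
        exact indicator_le_self' (fun _ _ => zero_le) x
      · have : m x = 0 := by
          simp only [hm, ← bot_eq_zero, Finset.sup_eq_bot_iff]
          intro i hi
          simp only [mem_iUnion, not_exists] at hx
          rw [indicator_of_notMem (hx i hi)]; rfl
        rw [indicator_of_notMem hx, this]
        simp [hp0]
    refine ne_top_of_le_ne_top ?_ (lintegral_mono hle)
    rw [lintegral_indicator_const (Finset.measurableSet_biUnion _ hR)]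
    refine ENNReal.mul_ne_top (ENNReal.rpow_ne_top_of_nonneg hp0.le ENNReal.coe_ne_top) ?_
    exact ((measure_biUnion_finset_le s R).trans_lt
      (ENNReal.sum_lt_top.2 fun i hi => (hfin i hi).lt_top)).ne
  have hmain : X ≤ ENNReal.ofReal (p / (p - 1)) ^ p * ∫⁻ x, F x ^ p ∂μ := by
    refine ENNReal.le_rpow_of_le_mul_rpow hpp hXfin (hcomp.trans ?_)
    rw [mul_assoc]
    gcongr
  refine le_trans ?_ hmain
  calc ∑ i ∈ s, (c i : ℝ≥0∞) ^ p * μ (E i)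
      ≤ ∑ i ∈ s, ∫⁻ x in E i, (m x : ℝ≥0∞) ^ p ∂μ := by
        refine Finset.sum_le_sum fun i hi => ?_
        rw [← setLIntegral_const]
        refine setLIntegral_mono' (hE i hi) fun x hx => ?_
        gcongr
        have := Finset.le_sup (f := fun i => (R i).indicator (fun _ => c i) x) hi
        simpa [hER i hi hx] using this
    _ = ∫⁻ x in ⋃ i ∈ s, E i, (m x : ℝ≥0∞) ^ p ∂μ := (lintegral_biUnion_finset hdis hE _).symm
    _ ≤ X := setLIntegral_le_lintegral _ _

/-! ### The Muckenhoupt condition on a single cube. -/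

/-- The letters `w`, `s`, `v` stand for the w-, σ- and Lebesgue measures of sets E ⊂ A ⊂ B. The
A_{p/r} condition on B and Hölder's inequality on E give (w_A/w_E)(σ_B/σ_E)^{p/r-1} ≤ K M^{p/r}.
This is raised to the power β - 1/p and multiplied by the A_{p/r} condition to the power 1/p. The
requirements β ≥ 1 and β ≥ 1/(p-r) are exactly those that make the resulting exponents at least 1 -
1/p and 1/p. -/
theorem two_weight_testing_real {p r : ℝ} (hr : 0 < r) (hrp : r < p)
    {wA wB wE sB sE vB vE M K : ℝ} (hwE : 0 < wE) (hsE : 0 < sE) (hvE : 0 < vE) (hvB : 0 < vB)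
    (hM : 0 < M) (hK : 0 < K) (hwEA : wE ≤ wA) (hwAB : wA ≤ wB) (hsEB : sE ≤ sB)
    (hv : vB ≤ M * vE) (hap : wB / vB * (sB / vB) ^ (p / r - 1) ≤ K)
    (hhol : vE ^ (p / r) ≤ wE * sE ^ (p / r - 1)) :
    (sB / vB) ^ (1 / r) * wA ≤ M ^ (p / r * (max 1 (1 / (p - r)) - 1 / p)) *
      K ^ max 1 (1 / (p - r)) * (sE ^ (1 / p) * wE ^ (1 - 1 / p)) := by
  have hp : 0 < p := hr.trans hrp
  have hwA : 0 < wA := hwE.trans_le hwEA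
  have hwB : 0 < wB := hwA.trans_le hwAB
  have hsB : 0 < sB := hsE.trans_le hsEB
  set β := max 1 (1 / (p - r)) with hβ
  have hβ1 : 1 ≤ β := le_max_left _ _
  have hβ2 : 1 / (p - r) ≤ β := le_max_right _ _
  have hm : 1 / p ≤ (β - 1 / p) * (p / r - 1) := by
    have h1 : 0 < p - r := by linarith
    have h2 : 0 < p / r - 1 := by rw [sub_pos, lt_div_iff₀ hr]; linarith
    calc 1 / p = (1 / (p - r) - 1 / p) * (p / r - 1) := by field_simp; ring
      _ ≤ _ := by gcongr
  -- After taking logarithms all hypotheses and the goal are linear in the logarithms of the masses.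
  rw [← Real.log_le_log_iff (by positivity) (by positivity)] at hap hhol hv ⊢
  have h3 := Real.log_le_log hwE hwEA
  have h4 := Real.log_le_log hwA hwAB
  have h5 := Real.log_le_log hsE hsEB
  rw [Real.log_mul (by positivity) (by positivity), Real.log_rpow (by positivity),
    Real.log_div (by positivity) (by positivity), Real.log_div (by positivity) (by positivity)]
    at hap
  rw [Real.log_mul (by positivity) (by positivity), Real.log_rpow (by positivity),
    Real.log_rpow (by positivity)] at hhol
  rw [Real.log_mul (by positivity) (by positivity)] at hv
  rw [Real.log_mul (by positivity) (by positivity), Real.log_rpow (by positivity),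
    Real.log_div (by positivity) (by positivity), Real.log_mul (by positivity) (by positivity),
    Real.log_mul (by positivity) (by positivity), Real.log_mul (by positivity) (by positivity),
    Real.log_rpow (by positivity), Real.log_rpow (by positivity), Real.log_rpow (by positivity),
    Real.log_rpow (by positivity)]
  generalize Real.log wE = lwE at *
  generalize Real.log wA = lwA at *
  generalize Real.log wB = lwB at *
  generalize Real.log sE = lsE at *
  generalize Real.log sB = lsB at *
  generalize Real.log vE = lvE at *
  generalize Real.log vB = lvB at *
  generalize Real.log M = lM at *
  generalize Real.log K = lK at *
  have hs : 0 < p / r := by positivity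
  set m := β - 1 / p with hmdef
  have hm0 : 0 ≤ m := by
    have : 1 / p ≤ 1 / (p - r) := one_div_le_one_div_of_le (by linarith) (by linarith)
    linarith
  have e0 : p / r * lvB ≤ p / r * (lM + lvE) := mul_le_mul_of_nonneg_left hv hs.le
  have e1 : (lwA - lwE) + (p / r - 1) * (lsB - lsE) ≤ lK + p / r * lM := by nlinarith
  have e2 := mul_le_mul_of_nonneg_left e1 hm0
  have e3 : (1 - 1 / p) * (lwA - lwE) ≤ m * (lwA - lwE) :=
    mul_le_mul_of_nonneg_right (by linarith) (by linarith)
  have e4 : (1 / p) * (lsB - lsE) ≤ m * (p / r - 1) * (lsB - lsE) :=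
    mul_le_mul_of_nonneg_right hm (by linarith)
  have e5 : 1 / p * (lwA + (p / r - 1) * lsB - p / r * lvB) ≤ 1 / p * lK :=
    mul_le_mul_of_nonneg_left (by nlinarith) (by positivity)
  have e6 : 1 / p * (p / r) = 1 / r := by field_simp
  have e7 : 1 / p * (lwA + (p / r - 1) * lsB - p / r * lvB) =
      1 / p * lwA + (1 / p * (p / r)) * lsB - 1 / p * lsB - (1 / p * (p / r)) * lvB := by ring
  rw [e7, e6] at e5
  have e8 : β = m + 1 / p := by rw [hmdef]; ring
  rw [e8]
  nlinarith

theorem two_weight_testing {p r : ℝ} (hr : 0 < r) (hrp : r < p)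
    {wA wB wE sB sE vB vE M K : ℝ≥0∞} (hwE : wE ≠ 0) (hsE : sE ≠ 0) (hvE : vE ≠ 0)
    (hwB : wB ≠ ⊤) (hsB : sB ≠ ⊤) (hvB : vB ≠ ⊤) (hMt : M ≠ ⊤) (hKt : K ≠ ⊤)
    (hwEA : wE ≤ wA) (hwAB : wA ≤ wB) (hsEB : sE ≤ sB) (hvEB : vE ≤ vB)
    (hv : vB ≤ M * vE) (hap : wB / vB * (sB / vB) ^ (p / r - 1) ≤ K)
    (hhol : vE ^ (p / r) ≤ wE * sE ^ (p / r - 1)) :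
    (sB / vB) ^ (1 / r) * wA ≤ M ^ (p / r * (max 1 (1 / (p - r)) - 1 / p)) *
      K ^ max 1 (1 / (p - r)) * (sE ^ (1 / p) * wE ^ (1 - 1 / p)) := by
  have hp : 0 < p := hr.trans hrp
  have hs1 : 0 < p / r - 1 := by rw [sub_pos, lt_div_iff₀ hr]; linarith
  have hwA : wA ≠ ⊤ := ne_top_of_le_ne_top hwB hwAB
  have hwEt : wE ≠ ⊤ := ne_top_of_le_ne_top hwA hwEA
  have hsEt : sE ≠ ⊤ := ne_top_of_le_ne_top hsB hsEB
  have hvEt : vE ≠ ⊤ := ne_top_of_le_ne_top hvB hvEB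
  have hvB0 : vB ≠ 0 := fun h => hvE (le_zero_iff.1 (h ▸ hvEB))
  have hsB0 : sB ≠ 0 := fun h => hsE (le_zero_iff.1 (h ▸ hsEB))
  have hwA0 : wA ≠ 0 := fun h => hwE (le_zero_iff.1 (h ▸ hwEA))
  have hwB0 : wB ≠ 0 := fun h => hwA0 (le_zero_iff.1 (h ▸ hwAB))
  have hM0 : M ≠ 0 := by rintro rfl; exact hvB0 (by simpa using hv)
  have hsv : sB / vB ≠ ⊤ := ENNReal.div_ne_top hsB hvB0
  have hsv0 : sB / vB ≠ 0 := by simp [ENNReal.div_eq_zero_iff, hsB0, hvB]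
  have hK0 : K ≠ 0 := by
    rintro rfl
    rw [nonpos_iff_eq_zero, mul_eq_zero, ENNReal.div_eq_zero_iff, ENNReal.rpow_eq_zero_iff] at hap
    simp_all
  have hβp : 0 ≤ max 1 (1 / (p - r)) - 1 / p := by
    have : 1 / p ≤ 1 / (p - r) := one_div_le_one_div_of_le (by linarith) (by linarith)
    linarith [le_max_right 1 (1 / (p - r))]
  have hβ0 : 0 ≤ max 1 (1 / (p - r)) := zero_le_one.trans (le_max_left _ _)
  have hwEr : wE ^ (1 - 1 / p) ≠ ⊤ := by simp [ENNReal.rpow_eq_top_iff, hwE, hwEt]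
  have hR : M ^ (p / r * (max 1 (1 / (p - r)) - 1 / p)) *
      K ^ max 1 (1 / (p - r)) * (sE ^ (1 / p) * wE ^ (1 - 1 / p)) ≠ ⊤ :=
    ENNReal.mul_ne_top (ENNReal.mul_ne_top
      (ENNReal.rpow_ne_top_of_nonneg (by positivity) hMt) (ENNReal.rpow_ne_top_of_nonneg hβ0 hKt))
      (ENNReal.mul_ne_top (ENNReal.rpow_ne_top_of_nonneg (by positivity) hsEt) hwEr)
  have hL : (sB / vB) ^ (1 / r) * wA ≠ ⊤ :=
    ENNReal.mul_ne_top (ENNReal.rpow_ne_top_of_nonneg (by positivity) hsv) hwA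
  rw [← ENNReal.toReal_le_toReal hL hR]
  have hv' := ENNReal.toReal_mono (ENNReal.mul_ne_top hMt hvEt) hv
  have hap' := ENNReal.toReal_mono hKt hap
  have hhol' := ENNReal.toReal_mono (ENNReal.mul_ne_top hwEt
    (ENNReal.rpow_ne_top_of_nonneg hs1.le hsEt)) hhol
  simp only [ENNReal.toReal_mul, ← ENNReal.toReal_rpow, ENNReal.toReal_div] at *
  exact two_weight_testing_real hr hrp (ENNReal.toReal_pos hwE hwEt) (ENNReal.toReal_pos hsE hsEt)
    (ENNReal.toReal_pos hvE hvEt) (ENNReal.toReal_pos hvB0 hvB) (ENNReal.toReal_pos hM0 hMt)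
    (ENNReal.toReal_pos hK0 hKt) (ENNReal.toReal_mono hwA hwEA) (ENNReal.toReal_mono hwB hwAB)
    (ENNReal.toReal_mono hsB hsEB) hv' hap' hhol'

/-! ### The weighted bound for finite sparse sums. -/

/-- Hölder's inequality for a weight and its dual weight. -/
theorem measure_rpow_le_withDensity_mul {α : Type*} [MeasurableSpace α] {μ : Measure α} {s : ℝ}
    (hs : 1 < s) {W : α → ℝ≥0∞} (hW : Measurable W) (hW0 : ∀ x, W x ≠ 0) (hWt : ∀ x, W x ≠ ⊤)
    {E : Set α} (hE : MeasurableSet E) :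
    μ E ^ s ≤ μ.withDensity W E *
      μ.withDensity (fun x => W x ^ (-(1 / (s - 1)))) E ^ (s - 1) := by
  have hs0 : 0 < s := by linarith
  have hs1 : 0 < s - 1 := by linarith
  have hss : s.HolderConjugate (s / (s - 1)) := Real.HolderConjugate.conjExponent hs
  -- Hölder's inequality for the factorisation 1 = W^{1/s} W^{-1/s}.
  have h := ENNReal.lintegral_mul_le_Lp_mul_Lq (μ.restrict E) hss
    (f := fun x => W x ^ (1 / s)) (g := fun x => W x ^ (-(1 / s)))
    (hW.pow_const _).aemeasurable (hW.pow_const _).aemeasurable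
  have h1 : ∀ x, ((fun x => W x ^ (1 / s)) * fun x => W x ^ (-(1 / s))) x = 1 := fun x => by
    simp only [Pi.mul_apply]
    rw [← ENNReal.rpow_add _ _ (hW0 x) (hWt x)]; simp
  simp only [h1, ← ENNReal.rpow_mul, lintegral_one, Measure.restrict_apply_univ] at h
  have h2 : 1 / s * s = 1 := by field_simp
  have h3 : -(1 / s) * (s / (s - 1)) = -(1 / (s - 1)) := by field_simp
  have h4 : 1 / (s / (s - 1)) * s = s - 1 := by field_simp
  rw [h2, h3] at h
  simp only [ENNReal.rpow_one] at h
  rw [withDensity_apply _ hE, withDensity_apply _ hE]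
  have h5 := ENNReal.rpow_le_rpow h hs0.le
  rwa [ENNReal.mul_rpow_of_nonneg _ _ hs0.le, ← ENNReal.rpow_mul, ← ENNReal.rpow_mul, h2, h4,
    ENNReal.rpow_one] at h5

/-- The `L^p(w)` bound for finite sparse sums. The sets `A i` on which the sum lives are enlarged
to `B i` for the averages; the sets `B i` are laminar within each colour class. -/
theorem lintegral_sparse_sum_rpow_le {α ι κ : Type*} [MeasurableSpace α] [Fintype κ]
    [DecidableEq κ] {μ : Measure α} {p r : ℝ} (hr : 1 ≤ r) (hrp : r < p) (t : Finset ι)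
    (A B E : ι → Set α) (col : ι → κ) (hA : ∀ i ∈ t, MeasurableSet (A i))
    (hB : ∀ i ∈ t, MeasurableSet (B i)) (hE : ∀ i ∈ t, MeasurableSet (E i))
    (hEA : ∀ i ∈ t, E i ⊆ A i) (hAB : ∀ i ∈ t, A i ⊆ B i)
    (hlamA : ∀ i ∈ t, ∀ j ∈ t, A i ⊆ A j ∨ A j ⊆ A i ∨ Disjoint (A i) (A j))
    (hlamB : ∀ i ∈ t, ∀ j ∈ t, col i = col j → B i ⊆ B j ∨ B j ⊆ B i ∨ Disjoint (B i) (B j))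
    (hdis : (t : Set ι).PairwiseDisjoint E) {M K : ℝ≥0∞} (hM : M ≠ ⊤) (hK : K ≠ ⊤)
    (hE0 : ∀ i ∈ t, μ (E i) ≠ 0) (hBt : ∀ i ∈ t, μ (B i) ≠ ⊤) (hBE : ∀ i ∈ t, μ (B i) ≤ M * μ (E i))
    {W : α → ℝ≥0∞} (hW : Measurable W) (hW0 : ∀ x, W x ≠ 0) (hWt : ∀ x, W x ≠ ⊤)
    (hwB : ∀ i ∈ t, μ.withDensity W (B i) ≠ ⊤)
    (hsB : ∀ i ∈ t, μ.withDensity (fun x => W x ^ (-(1 / (p / r - 1)))) (B i) ≠ ⊤)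
    (hap : ∀ i ∈ t, μ.withDensity W (B i) / μ (B i) *
      (μ.withDensity (fun x => W x ^ (-(1 / (p / r - 1)))) (B i) / μ (B i)) ^ (p / r - 1) ≤ K)
    {φ : α → ℝ≥0∞} (hφ : Measurable φ) (lam : ι → ℝ≥0)
    (hlam : ∀ i ∈ t, (lam i : ℝ≥0∞) ^ r * μ (B i) ≤ ∫⁻ x in B i, φ x ^ r ∂μ) :
    ∫⁻ x, (∑ i ∈ t, (A i).indicator (fun _ => (lam i : ℝ≥0∞)) x) ^ p ∂μ.withDensity W ≤
      (M ^ (p / r * (max 1 (1 / (p - r)) - 1 / p)) * K ^ max 1 (1 / (p - r)) *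
        ((Fintype.card κ : ℝ≥0∞) ^ (1 / p) * ENNReal.ofReal (p / r / (p / r - 1)) ^ (1 / r)) *
        ENNReal.ofReal p) ^ p * ∫⁻ x, φ x ^ p ∂μ.withDensity W := by
  classical
  have hr0 : 0 < r := by linarith
  have hp0 : 0 < p := by linarith
  have hp1 : 1 < p := by linarith
  have hs : 1 < p / r := (one_lt_div hr0).2 hrp
  have hs1 : 0 < p / r - 1 := by linarith
  have hpp : p.HolderConjugate (p / (p - 1)) := Real.HolderConjugate.conjExponent hp1
  have hp' : 1 / (p / (p - 1)) = 1 - 1 / p := by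
    have : p - 1 ≠ 0 := by linarith
    field_simp
  set S : α → ℝ≥0∞ := fun x => W x ^ (-(1 / (p / r - 1))) with hSdef
  have hS : Measurable S := hW.pow_const _
  have hS0 : ∀ x, S x ≠ 0 := fun x => by simp [hSdef, hW0, hWt]
  have hSt : ∀ x, S x ≠ ⊤ := fun x => by
    simp [hSdef, ENNReal.rpow_eq_top_iff, hW0, hWt]
  set w := μ.withDensity W with hw
  set σ := μ.withDensity S with hσ
  have hpos : ∀ {V : α → ℝ≥0∞}, Measurable V → (∀ x, V x ≠ 0) → ∀ i ∈ t,
      μ.withDensity V (E i) ≠ 0 := by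
    intro V hV hV0 i hi h
    rw [withDensity_apply _ (hE i hi), lintegral_eq_zero_iff hV, Filter.EventuallyEq,
      ae_restrict_iff' (hE i hi)] at h
    refine hE0 i hi (measure_mono_null ?_ h)
    intro x hx
    simp [hx, hV0]
  have hwE := hpos hW hW0
  have hsE := hpos hS hS0
  have hEB : ∀ i ∈ t, E i ⊆ B i := fun i hi => (hEA i hi).trans (hAB i hi)
  have hsB0 : ∀ i ∈ t, σ (B i) ≠ 0 := fun i hi h => hsE i hi (measure_mono_null (hEB i hi) h)
  have hvB0 : ∀ i ∈ t, μ (B i) ≠ 0 := fun i hi h => hE0 i hi (measure_mono_null (hEB i hi) h)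
  have hwA0 : ∀ i ∈ t, w (A i) ≠ 0 := fun i hi h => hwE i hi (measure_mono_null (hEA i hi) h)
  have hwAt : ∀ i ∈ t, w (A i) ≠ ⊤ := fun i hi =>
    ne_top_of_le_ne_top (hwB i hi) (measure_mono (hAB i hi))
  set C := M ^ (p / r * (max 1 (1 / (p - r)) - 1 / p)) * K ^ max 1 (1 / (p - r)) with hC
  have htest : ∀ i ∈ t, (σ (B i) / μ (B i)) ^ (1 / r) * w (A i) ≤
      C * (σ (E i) ^ (1 / p) * w (E i) ^ (1 - 1 / p)) := fun i hi =>
    two_weight_testing hr0 hrp (hwE i hi) (hsE i hi) (hE0 i hi) (hwB i hi) (hsB i hi) (hBt i hi)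
      hM hK (measure_mono (hEA i hi)) (measure_mono (hAB i hi)) (measure_mono (hEB i hi))
      (measure_mono (hEB i hi)) (hBE i hi) (hap i hi)
      (measure_rpow_le_withDensity_mul hs hW hW0 hWt (hE i hi))
  set G : α → ℝ≥0∞ := fun x => ∑ i ∈ t, (A i).indicator (fun _ => (lam i : ℝ≥0∞)) x with hG
  have hGm : Measurable G :=
    Finset.measurable_fun_sum _ fun i hi => measurable_const.indicator (hA i hi)
  have hGle : ∀ x, G x ≤ ∑ i ∈ t, (lam i : ℝ≥0∞) := fun x =>
    Finset.sum_le_sum fun i _ => indicator_le_self' (fun _ _ => zero_le) x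
  have hsum : (∑ i ∈ t, (lam i : ℝ≥0∞)) ≠ ⊤ := ENNReal.sum_ne_top.2 fun i _ => ENNReal.coe_ne_top
  set X := ∫⁻ x, G x ^ p ∂w with hX
  -- Instead of a dual function, the sum is tested against its own power G^{p-1}.
  have hsplit : X = ∑ i ∈ t, lam i * ∫⁻ x in A i, G x ^ (p - 1) ∂w := by
    have : ∀ x, G x ^ p =
        ∑ i ∈ t, (A i).indicator (fun y => (lam i : ℝ≥0∞) * G y ^ (p - 1)) x := by
      intro x
      have hGt : G x ≠ ⊤ := ne_top_of_le_ne_top hsum (hGle x)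
      have h1 : G x ^ p = G x * G x ^ (p - 1) := by
        rcases eq_or_ne (G x) 0 with h0 | h0
        · simp [h0, hp0]
        · nth_rewrite 2 [← ENNReal.rpow_one (G x)]
          rw [← ENNReal.rpow_add _ _ h0 hGt]; ring_nf
      rw [h1]
      nth_rewrite 1 [hG]
      rw [Finset.sum_mul]
      refine Finset.sum_congr rfl fun i _ => ?_
      by_cases hx : x ∈ A i <;> simp [hx]
    rw [hX, lintegral_congr this, lintegral_finsetSum' _ fun i hi => ?_]
    · refine Finset.sum_congr rfl fun i hi => ?_
      rw [lintegral_indicator (hA i hi), lintegral_const_mul _ (hGm.pow_const _)]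
    · exact (((hGm.pow_const _).const_mul _).indicator (hA i hi)).aemeasurable
  have hGint : ∀ i ∈ t, ∫⁻ x in A i, G x ^ (p - 1) ∂w ≠ ⊤ := by
    intro i hi
    refine ne_top_of_le_ne_top ?_ (setLIntegral_mono' (hA i hi)
      fun x _ => ENNReal.rpow_le_rpow (hGle x) (by linarith : 0 ≤ p - 1))
    rw [setLIntegral_const]
    exact ENNReal.mul_ne_top (ENNReal.rpow_ne_top_of_nonneg (by linarith) hsum) (hwAt i hi)
  have hXt : X ≠ ⊤ := by
    rw [hsplit]
    exact ENNReal.sum_ne_top.2 fun i hi => ENNReal.mul_ne_top ENNReal.coe_ne_top (hGint i hi)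
  -- averages
  set F : α → ℝ≥0∞ := fun x => φ x ^ r / S x with hF
  have hFm : Measurable F := (hφ.pow_const _).div hS
  have hSF : ∀ x, S x * F x = φ x ^ r := fun x => by
    rw [hF, ENNReal.mul_div_cancel (hS0 x) (hSt x)]
  -- `F` satisfies F σ = φ^r, so `hlam` says that c_i is at most the σ-average of F over B_i.
  -- Likewise `d` is the w-average of G^{p-1} over A_i.
  set c : ι → ℝ≥0 := fun i => ((lam i : ℝ≥0∞) ^ r * μ (B i) / σ (B i)).toNNReal with hc
  set d : ι → ℝ≥0 := fun i => ((∫⁻ x in A i, G x ^ (p - 1) ∂w) / w (A i)).toNNReal with hd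
  have hcc : ∀ i ∈ t, (c i : ℝ≥0∞) = (lam i : ℝ≥0∞) ^ r * μ (B i) / σ (B i) := fun i hi =>
    ENNReal.coe_toNNReal (ENNReal.div_ne_top (ENNReal.mul_ne_top
      (ENNReal.rpow_ne_top_of_nonneg hr0.le ENNReal.coe_ne_top) (hBt i hi)) (hsB0 i hi))
  have hdd : ∀ i ∈ t, (d i : ℝ≥0∞) = (∫⁻ x in A i, G x ^ (p - 1) ∂w) / w (A i) := fun i hi =>
    ENNReal.coe_toNNReal (ENNReal.div_ne_top (hGint i hi) (hwA0 i hi))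
  have hterm : ∀ i ∈ t, lam i * ∫⁻ x in A i, G x ^ (p - 1) ∂w ≤
      C * (((c i : ℝ≥0∞) ^ (p / r) * σ (E i)) ^ (1 / p) *
        ((d i : ℝ≥0∞) ^ (p / (p - 1)) * w (E i)) ^ (1 / (p / (p - 1)))) := by
    intro i hi
    have h1 : (lam i : ℝ≥0∞) = (c i : ℝ≥0∞) ^ (1 / r) * (σ (B i) / μ (B i)) ^ (1 / r) := by
      rw [← ENNReal.mul_rpow_of_nonneg _ _ (by positivity), hcc i hi, mul_div,
        ENNReal.div_mul_cancel (hsB0 i hi) (hsB i hi),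
        ENNReal.mul_div_cancel_right (hvB0 i hi) (hBt i hi), ← ENNReal.rpow_mul,
        mul_one_div_cancel hr0.ne', ENNReal.rpow_one]
    have h2 : ∫⁻ x in A i, G x ^ (p - 1) ∂w = d i * w (A i) := by
      rw [hdd i hi, ENNReal.div_mul_cancel (hwA0 i hi) (hwAt i hi)]
    have h3 : ((c i : ℝ≥0∞) ^ (p / r) * σ (E i)) ^ (1 / p) =
        (c i : ℝ≥0∞) ^ (1 / r) * σ (E i) ^ (1 / p) := by
      rw [ENNReal.mul_rpow_of_nonneg _ _ (by positivity), ← ENNReal.rpow_mul]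
      congr 2; field_simp
    have h4 : ((d i : ℝ≥0∞) ^ (p / (p - 1)) * w (E i)) ^ (1 / (p / (p - 1))) =
        d i * w (E i) ^ (1 - 1 / p) := by
      rw [ENNReal.mul_rpow_of_nonneg _ _ hpp.symm.one_div_nonneg, ← ENNReal.rpow_mul,
        mul_one_div_cancel hpp.symm.ne_zero, ENNReal.rpow_one, hp']
    rw [h2, h3, h4]
    nth_rewrite 1 [h1]
    calc (c i : ℝ≥0∞) ^ (1 / r) * (σ (B i) / μ (B i)) ^ (1 / r) * (d i * w (A i))
        = (c i : ℝ≥0∞) ^ (1 / r) * d i * ((σ (B i) / μ (B i)) ^ (1 / r) * w (A i)) := by ring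
      _ ≤ (c i : ℝ≥0∞) ^ (1 / r) * d i * (C * (σ (E i) ^ (1 / p) * w (E i) ^ (1 - 1 / p))) := by
          exact mul_le_mul' le_rfl (htest i hi)
      _ = _ := by ring
  -- Embedding with respect to σ and exponent p/r, colour by colour; ∫ F^{p/r} dσ equals ∫ φ^p dw by
  -- the choice of σ.
  have hcar1 : ∑ i ∈ t, (c i : ℝ≥0∞) ^ (p / r) * σ (E i) ≤ Fintype.card κ *
      (ENNReal.ofReal (p / r / (p / r - 1)) ^ (p / r) * ∫⁻ x, φ x ^ p ∂w) := by
    have hFint : ∫⁻ x, F x ^ (p / r) ∂σ = ∫⁻ x, φ x ^ p ∂w := by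
      rw [hσ, hw, lintegral_withDensity_eq_lintegral_mul _ hS (hFm.pow_const _),
        lintegral_withDensity_eq_lintegral_mul _ hW (hφ.pow_const _)]
      refine lintegral_congr fun x => ?_
      simp only [Pi.mul_apply, hF]
      rw [ENNReal.div_rpow_of_nonneg _ _ (by linarith), ← ENNReal.rpow_mul,
        mul_div_cancel₀ _ hr0.ne', div_eq_mul_inv, ← ENNReal.rpow_neg, mul_left_comm]
      nth_rewrite 1 [← ENNReal.rpow_one (S x)]
      rw [← ENNReal.rpow_add _ _ (hS0 x) (hSt x), hSdef, ← ENNReal.rpow_mul,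
        show -(1 / (p / r - 1)) * (1 + -(p / r)) = 1 by
          rw [show 1 + -(p / r) = -(p / r - 1) by ring, neg_mul_neg, one_div_mul_cancel hs1.ne'],
        ENNReal.rpow_one, mul_comm]
    have hcol : ∀ k : κ, ∑ i ∈ t with col i = k, (c i : ℝ≥0∞) ^ (p / r) * σ (E i) ≤
        ENNReal.ofReal (p / r / (p / r - 1)) ^ (p / r) * ∫⁻ x, φ x ^ p ∂w := by
      intro k
      rw [← hFint]
      have hmem : ∀ i ∈ t.filter (fun i => col i = k), i ∈ t := fun i hi =>
        (Finset.mem_filter.1 hi).1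
      refine carleson_embedding_of_laminar hs _ B E (fun i hi => hB i (hmem i hi))
        (fun i hi => hE i (hmem i hi)) (fun i hi => hEB i (hmem i hi))
        (fun i hi j hj => hlamB i (hmem i hi) j (hmem j hj)
          ((Finset.mem_filter.1 hi).2.trans (Finset.mem_filter.1 hj).2.symm))
        (hdis.subset fun i hi => hmem i hi) (fun i hi => hsB i (hmem i hi)) c F hFm.aemeasurable
        fun i hi => ?_
      rw [hcc i (hmem i hi), ENNReal.div_mul_cancel (hsB0 i (hmem i hi)) (hsB i (hmem i hi))]
      refine (hlam i (hmem i hi)).trans_eq ?_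
      rw [hσ, setLIntegral_withDensity_eq_setLIntegral_mul _ hS hFm (hB i (hmem i hi))]
      exact lintegral_congr fun x => (hSF x).symm
    calc ∑ i ∈ t, (c i : ℝ≥0∞) ^ (p / r) * σ (E i)
        = ∑ k : κ, ∑ i ∈ t with col i = k, (c i : ℝ≥0∞) ^ (p / r) * σ (E i) :=
          (Finset.sum_fiberwise t col _).symm
      _ ≤ ∑ _k : κ, ENNReal.ofReal (p / r / (p / r - 1)) ^ (p / r) * ∫⁻ x, φ x ^ p ∂w :=
          Finset.sum_le_sum fun k _ => hcol k
      _ = _ := by simp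
  -- Embedding with respect to w and exponent p'. The conjugate exponent of p' is p, hence the
  -- constant, and (G^{p-1})^{p'} = G^p reproduces X.
  have hcar2 : ∑ i ∈ t, (d i : ℝ≥0∞) ^ (p / (p - 1)) * w (E i) ≤
      ENNReal.ofReal p ^ (p / (p - 1)) * X := by
    have hq : 1 < p / (p - 1) := hpp.symm.lt
    have h := carleson_embedding_of_laminar hq t A E hA hE hEA hlamA hdis hwAt d
      (fun x => G x ^ (p - 1)) (hGm.pow_const _).aemeasurable fun i hi => by
        rw [hdd i hi, ENNReal.div_mul_cancel (hwA0 i hi) (hwAt i hi)]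
    have e1 : p / (p - 1) / (p / (p - 1) - 1) = p := by
      have : p - 1 ≠ 0 := by linarith
      field_simp; ring
    have e2 : (p - 1) * (p / (p - 1)) = p := by
      have : p - 1 ≠ 0 := by linarith
      field_simp
    simpa only [e1, ← ENNReal.rpow_mul, e2] using h
  refine ENNReal.le_rpow_of_le_mul_rpow hpp hXt ?_
  calc X = ∑ i ∈ t, lam i * ∫⁻ x in A i, G x ^ (p - 1) ∂w := hsplit
    _ ≤ ∑ i ∈ t, C * (((c i : ℝ≥0∞) ^ (p / r) * σ (E i)) ^ (1 / p) *
        ((d i : ℝ≥0∞) ^ (p / (p - 1)) * w (E i)) ^ (1 / (p / (p - 1)))) :=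
        Finset.sum_le_sum hterm
    _ = C * ∑ i ∈ t, ((c i : ℝ≥0∞) ^ (p / r) * σ (E i)) ^ (1 / p) *
        ((d i : ℝ≥0∞) ^ (p / (p - 1)) * w (E i)) ^ (1 / (p / (p - 1))) :=
        (Finset.mul_sum _ _ _).symm
    _ ≤ C * ((∑ i ∈ t, (c i : ℝ≥0∞) ^ (p / r) * σ (E i)) ^ (1 / p) *
        (∑ i ∈ t, (d i : ℝ≥0∞) ^ (p / (p - 1)) * w (E i)) ^ (1 / (p / (p - 1)))) := by
        gcongr
        refine (ENNReal.inner_le_Lp_mul_Lq t _ _ hpp).trans_eq ?_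
        simp only [← ENNReal.rpow_mul, one_div_mul_cancel hp0.ne',
          one_div_mul_cancel hpp.symm.ne_zero, ENNReal.rpow_one]
    _ ≤ C * ((Fintype.card κ * (ENNReal.ofReal (p / r / (p / r - 1)) ^ (p / r) *
          ∫⁻ x, φ x ^ p ∂w)) ^ (1 / p) *
        (ENNReal.ofReal p ^ (p / (p - 1)) * X) ^ (1 / (p / (p - 1)))) := by
        have := hpp.symm.one_div_nonneg
        gcongr
    _ = _ := by
        rw [ENNReal.mul_rpow_of_nonneg _ _ (by positivity),
          ENNReal.mul_rpow_of_nonneg _ _ (by positivity),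
          ENNReal.mul_rpow_of_nonneg _ _ hpp.symm.one_div_nonneg, ← ENNReal.rpow_mul,
          ← ENNReal.rpow_mul, mul_one_div_cancel hpp.symm.ne_zero, ENNReal.rpow_one,
          show p / r * (1 / p) = 1 / r by field_simp]
        ring

/-! ### Dyadic cubes and their triples. -/

section DyadicGeometry

variable {n : ℕ}

theorem mem_cube {a : Fin n → ℝ} {h : ℝ} {x : Fin n → ℝ} :
    x ∈ cube a h ↔ ∀ i, a i ≤ x i ∧ x i < a i + h := by
  simp [cube, Set.mem_pi, mem_Ico]

theorem mem_tripleCube {a : Fin n → ℝ} {h : ℝ} {x : Fin n → ℝ} :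
    x ∈ tripleCube a h ↔ ∀ i, a i - h ≤ x i ∧ x i < a i + 2 * h := by
  rw [tripleCube, mem_cube]
  refine forall_congr' fun i => and_congr_right fun _ => ?_
  ring_nf

theorem measurableSet_cube (a : Fin n → ℝ) (h : ℝ) : MeasurableSet (cube a h) :=
  MeasurableSet.univ_pi fun _ => measurableSet_Ico

theorem measurableSet_tripleCube (a : Fin n → ℝ) (h : ℝ) : MeasurableSet (tripleCube a h) :=
  measurableSet_cube _ _

theorem volume_cube (a : Fin n → ℝ) (h : ℝ) : volume (cube a h) = ENNReal.ofReal h ^ n := by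
  rw [cube, Real.volume_pi_Ico]; simp

theorem volume_tripleCube (a : Fin n → ℝ) (h : ℝ) :
    volume (tripleCube a h) = 3 ^ n * volume (cube a h) := by
  rw [tripleCube, volume_cube, volume_cube, ENNReal.ofReal_mul (by norm_num), mul_pow]
  simp

theorem volume_cube_ne_zero (a : Fin n → ℝ) {h : ℝ} (hh : 0 < h) : volume (cube a h) ≠ 0 := by
  rw [volume_cube]; exact pow_ne_zero _ (ENNReal.ofReal_pos.2 hh).ne'

theorem volume_cube_ne_top (a : Fin n → ℝ) (h : ℝ) : volume (cube a h) ≠ ⊤ := by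
  rw [volume_cube]; exact ENNReal.pow_ne_top ENNReal.ofReal_ne_top

theorem volume_tripleCube_ne_top (a : Fin n → ℝ) (h : ℝ) : volume (tripleCube a h) ≠ ⊤ :=
  volume_cube_ne_top _ _

theorem volume_tripleCube_ne_zero (a : Fin n → ℝ) {h : ℝ} (hh : 0 < h) :
    volume (tripleCube a h) ≠ 0 :=
  volume_cube_ne_zero _ (by linarith)

theorem cube_subset_tripleCube (a : Fin n → ℝ) {h : ℝ} (hh : 0 < h) :
    cube a h ⊆ tripleCube a h := fun x hx => by
  rw [mem_cube] at hx
  rw [mem_tripleCube]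
  exact fun i => ⟨by linarith [(hx i).1], by linarith [(hx i).2]⟩

theorem tripleCube_subset_tripleCube {a a' : Fin n → ℝ} {h h' : ℝ} (hh' : 0 < h')
    (hsub : cube a' h' ⊆ cube a h) : tripleCube a' h' ⊆ tripleCube a h := by
  have h1 : a' ∈ cube a h := hsub (mem_cube.2 fun i => ⟨le_rfl, by linarith⟩)
  rw [mem_cube] at h1
  have h2 : ∀ i, a' i + h' ≤ a i + h := by
    intro i
    by_contra hlt
    push Not at hlt
    -- If the small cube stuck out in direction i, its corner moved to the excluded face of the
    -- large cube would still lie in the small cube.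
    have hy : Function.update a' i (a i + h) ∈ cube a h := by
      refine hsub (mem_cube.2 fun j => ?_)
      by_cases hj : j = i
      · subst hj
        simp only [Function.update_self]
        exact ⟨(h1 j).2.le, hlt⟩
      · simp only [Function.update_of_ne hj]
        exact ⟨le_rfl, by linarith⟩
    have := (mem_cube.1 hy i).2
    simp at this
  intro x hx
  rw [mem_tripleCube] at hx ⊢
  exact fun i => ⟨by linarith [(hx i).1, (h1 i).1, h2 i], by linarith [(hx i).2, (h1 i).1, h2 i]⟩

/-- The cubes of the dyadic lattice generated by `cube a h`, indexed by generation and position. -/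
noncomputable def dyadicCorner (a : Fin n → ℝ) (h : ℝ) (Q : ℕ × (Fin n → ℤ)) : Fin n → ℝ :=
  fun i => a i + Q.2 i * (h / 2 ^ Q.1)

noncomputable def dyadicCube (a : Fin n → ℝ) (h : ℝ) (Q : ℕ × (Fin n → ℤ)) : Set (Fin n → ℝ) :=
  cube (dyadicCorner a h Q) (h / 2 ^ Q.1)

noncomputable def dyadicTriple (a : Fin n → ℝ) (h : ℝ) (Q : ℕ × (Fin n → ℤ)) : Set (Fin n → ℝ) :=
  tripleCube (dyadicCorner a h Q) (h / 2 ^ Q.1)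

/-- The index of the dyadic cube of generation `j` that contains `x`. -/
noncomputable def dyadicIndex (a : Fin n → ℝ) (h : ℝ) (j : ℕ) (x : Fin n → ℝ) :
    ℕ × (Fin n → ℤ) :=
  (j, fun i => ⌊(x i - a i) / h * 2 ^ j⌋)

variable {a : Fin n → ℝ} {h : ℝ}

theorem dyadicCorner_zero : dyadicCorner a h (0, 0) = a := by
  ext i; simp [dyadicCorner]

theorem dyadicCube_zero : dyadicCube a h (0, 0) = cube a h := by
  simp [dyadicCube, dyadicCorner_zero]

theorem dyadicTriple_zero : dyadicTriple a h (0, 0) = tripleCube a h := by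
  simp [dyadicTriple, dyadicCorner_zero]

theorem side_pos (hh : 0 < h) (j : ℕ) : 0 < h / 2 ^ j := by positivity

/-- For half-open cubes, membership is an identity between integer parts. Each generation therefore
partitions the space, and nesting becomes arithmetic of floors. -/
theorem mem_dyadicCube_iff (hh : 0 < h) {Q : ℕ × (Fin n → ℤ)} {x : Fin n → ℝ} :
    x ∈ dyadicCube a h Q ↔ dyadicIndex a h Q.1 x = Q := by
  obtain ⟨j, m⟩ := Q
  simp only [dyadicCube, dyadicCorner, mem_cube, dyadicIndex, Prod.mk.injEq, true_and, funext_iff,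
    Int.floor_eq_iff]
  refine forall_congr' fun i => ?_
  have h2 : (0 : ℝ) < 2 ^ j := by positivity
  rw [show (x i - a i) / h * 2 ^ j = (x i - a i) / (h / 2 ^ j) by field_simp,
    le_div_iff₀ (by positivity), div_lt_iff₀ (by positivity)]
  constructor <;> rintro ⟨h1, h3⟩ <;> constructor <;> linarith

theorem mem_dyadicCube_dyadicIndex (hh : 0 < h) (j : ℕ) (x : Fin n → ℝ) :
    x ∈ dyadicCube a h (dyadicIndex a h j x) := (mem_dyadicCube_iff hh).2 rfl

theorem dyadicCube_subset_of_mem (hh : 0 < h) {Q P : ℕ × (Fin n → ℤ)} (hQP : Q.1 ≤ P.1)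
    {x : Fin n → ℝ} (hxQ : x ∈ dyadicCube a h Q) (hxP : x ∈ dyadicCube a h P) :
    dyadicCube a h P ⊆ dyadicCube a h Q := by
  intro y hy
  obtain ⟨j, m⟩ := Q
  obtain ⟨j', m'⟩ := P
  obtain ⟨d, rfl⟩ : ∃ d, j' = j + d := ⟨j' - j, by simp at hQP; omega⟩
  rw [mem_dyadicCube_iff hh] at *
  simp only [dyadicIndex, Prod.mk.injEq, true_and, funext_iff] at *
  intro i
  rw [← hxQ i]
  -- Passing to a coarser generation drops d binary digits, which is integer division by 2^d.
  have key : ∀ u : ℝ, ⌊u * 2 ^ j⌋ = ⌊u * 2 ^ (j + d)⌋ / ((2 ^ d : ℕ) : ℤ) := by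
    intro u
    rw [← Int.floor_div_natCast]
    congr 1
    push_cast
    field_simp
    ring
  rw [key, key, hxP i, hy i]

theorem dyadicCube_laminar (hh : 0 < h) (Q P : ℕ × (Fin n → ℤ)) :
    dyadicCube a h Q ⊆ dyadicCube a h P ∨ dyadicCube a h P ⊆ dyadicCube a h Q ∨
      Disjoint (dyadicCube a h Q) (dyadicCube a h P) := by
  by_cases hd : Disjoint (dyadicCube a h Q) (dyadicCube a h P)
  · exact Or.inr (Or.inr hd)
  · obtain ⟨x, hxQ, hxP⟩ := not_disjoint_iff.1 hd
    rcases le_total Q.1 P.1 with hle | hle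
    · exact Or.inr (Or.inl (dyadicCube_subset_of_mem hh hle hxQ hxP))
    · exact Or.inl (dyadicCube_subset_of_mem hh hle hxP hxQ)

/-- Tripled dyadic cubes of the same colour form a laminar family. -/
def dyadicColour (Q : ℕ × (Fin n → ℤ)) : Fin n → ZMod 3 := fun i => 2 ^ Q.1 * ((Q.2 i : ZMod 3) - 1)

theorem mem_dyadicTriple_iff (hh : 0 < h) {Q : ℕ × (Fin n → ℤ)} {x : Fin n → ℝ} :
    x ∈ dyadicTriple a h Q ↔ ∀ i, ((Q.2 i - 1 : ℤ) : ℝ) ≤ (x i - a i) / h * 2 ^ Q.1 ∧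
      (x i - a i) / h * 2 ^ Q.1 < ((Q.2 i - 1 : ℤ) : ℝ) + 3 := by
  obtain ⟨j, m⟩ := Q
  simp only [dyadicTriple, dyadicCorner, mem_tripleCube]
  refine forall_congr' fun i => ?_
  have h2 : (0 : ℝ) < 2 ^ j := by positivity
  rw [show (x i - a i) / h * 2 ^ j = (x i - a i) / (h / 2 ^ j) by field_simp,
    le_div_iff₀ (by positivity), div_lt_iff₀ (by positivity)]
  push_cast
  constructor <;> rintro ⟨h1, h3⟩ <;> constructor <;> linarith

/-- In each coordinate and in units of the finer side, the triples are [2^d l, 2^d l + 3·2^d) and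
[l', l' + 3). Since 2·2 = 1 modulo 3, equal colours mean l' = 2^d l + 3z. Intervals of length 3 with
such endpoints tile the coarse one, and overlap forces 0 ≤ z < 2^d. -/
theorem dyadicTriple_subset_of_mem (hh : 0 < h) {Q P : ℕ × (Fin n → ℤ)} (hQP : Q.1 ≤ P.1)
    (hc : dyadicColour Q = dyadicColour P) {x : Fin n → ℝ} (hxQ : x ∈ dyadicTriple a h Q)
    (hxP : x ∈ dyadicTriple a h P) : dyadicTriple a h P ⊆ dyadicTriple a h Q := by
  intro y hy
  obtain ⟨j, m⟩ := Q
  obtain ⟨j', m'⟩ := P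
  obtain ⟨d, rfl⟩ : ∃ d, j' = j + d := ⟨j' - j, by simp at hQP; omega⟩
  rw [mem_dyadicTriple_iff hh] at *
  intro i
  have hci := congrFun hc i
  simp only [dyadicColour] at hci
  replace hxQ := hxQ i
  replace hxP := hxP i
  replace hy := hy i
  dsimp only at *
  generalize hl : m i - 1 = l at *
  generalize hl' : m' i - 1 = l' at *
  have hl3 : (m i : ZMod 3) - 1 = (l : ZMod 3) := by rw [← hl]; push_cast; rfl
  have hl3' : (m' i : ZMod 3) - 1 = (l' : ZMod 3) := by rw [← hl']; push_cast; rfl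
  rw [hl3, hl3'] at hci
  have h22 : ∀ k : ℕ, (2 : ZMod 3) ^ k * 2 ^ k = 1 := fun k => by
    rw [← mul_pow, show (2 : ZMod 3) * 2 = 1 by decide, one_pow]
  have hmod : ((l' - 2 ^ d * l : ℤ) : ZMod 3) = 0 := by
    push_cast
    have : (l : ZMod 3) = 2 ^ d * l' := by
      calc (l : ZMod 3) = 2 ^ j * 2 ^ j * l := by rw [h22, one_mul]
        _ = 2 ^ j * (2 ^ j * l) := by ring
        _ = 2 ^ j * (2 ^ (j + d) * l') := by rw [hci]
        _ = (2 ^ j * 2 ^ j) * (2 ^ d * l') := by ring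
        _ = _ := by rw [h22, one_mul]
    rw [this, ← mul_assoc, h22, one_mul, sub_self]
  obtain ⟨z, hz⟩ := (ZMod.intCast_zmod_eq_zero_iff_dvd _ 3).1 hmod
  have hl'z : l' = 2 ^ d * l + 3 * z := by push_cast at hz; linarith
  have hD : (0 : ℝ) < 2 ^ d := by positivity
  simp only [pow_add, ← mul_assoc] at *
  generalize (x i - a i) / h * 2 ^ j = u at *
  generalize (y i - a i) / h * 2 ^ j = v at *
  have hl'r : (l' : ℝ) = 2 ^ d * l + 3 * z := by rw [hl'z]; push_cast; ring
  rw [hl'r] at hxP hy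
  have hz0 : 0 ≤ z := by
    have : (-1 : ℝ) < z := by nlinarith [mul_le_mul_of_nonneg_left hxQ.1 hD.le]
    have : (-1 : ℤ) < z := by exact_mod_cast this
    omega
  have hz1 : z + 1 ≤ 2 ^ d := by
    have : (z : ℝ) < 2 ^ d := by nlinarith [mul_lt_mul_of_pos_left hxQ.2 hD]
    have : z < 2 ^ d := by exact_mod_cast this
    omega
  have hz0r : (0 : ℝ) ≤ z := by exact_mod_cast hz0
  have hz1r : (z : ℝ) + 1 ≤ 2 ^ d := by exact_mod_cast hz1
  constructor
  · refine le_of_mul_le_mul_right ?_ hD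
    nlinarith [hy.1]
  · refine lt_of_mul_lt_mul_right ?_ hD.le
    nlinarith [hy.2]

theorem dyadicTriple_laminar (hh : 0 < h) (Q P : ℕ × (Fin n → ℤ))
    (hc : dyadicColour Q = dyadicColour P) :
    dyadicTriple a h Q ⊆ dyadicTriple a h P ∨ dyadicTriple a h P ⊆ dyadicTriple a h Q ∨
      Disjoint (dyadicTriple a h Q) (dyadicTriple a h P) := by
  by_cases hd : Disjoint (dyadicTriple a h Q) (dyadicTriple a h P)
  · exact Or.inr (Or.inr hd)
  · obtain ⟨x, hxQ, hxP⟩ := not_disjoint_iff.1 hd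
    rcases le_total Q.1 P.1 with hle | hle
    · exact Or.inr (Or.inl (dyadicTriple_subset_of_mem hh hle hc hxQ hxP))
    · exact Or.inl (dyadicTriple_subset_of_mem hh hle hc.symm hxP hxQ)

theorem exists_dyadicCube_subset_of_isOpen (hh : 0 < h) {U : Set (Fin n → ℝ)} (hU : IsOpen U)
    {x : Fin n → ℝ} (hx : x ∈ U) (k : ℕ) :
    ∃ j, k < j ∧ dyadicCube a h (dyadicIndex a h j x) ⊆ U := by
  obtain ⟨ε, hε, hball⟩ := Metric.isOpen_iff.1 hU x hx
  obtain ⟨N, hN⟩ := exists_pow_lt_of_lt_one (div_pos hε hh) (by norm_num : (1 / 2 : ℝ) < 1)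
  refine ⟨max N (k + 1), lt_max_of_lt_right (Nat.lt_succ_self k), fun y hy => hball ?_⟩
  have hx' := mem_dyadicCube_dyadicIndex (a := a) hh (max N (k + 1)) x
  have hside : h / 2 ^ max N (k + 1) < ε := by
    rw [div_pow, one_pow, div_lt_div_iff₀ (by positivity) hh, one_mul] at hN
    rw [div_lt_iff₀ (by positivity)]
    calc h < ε * 2 ^ N := hN
      _ ≤ ε * 2 ^ max N (k + 1) := by
        gcongr
        · norm_num
        · exact le_max_left _ _
  rw [Metric.mem_ball, dist_pi_lt_iff hε]
  intro i
  have h1 := mem_cube.1 hx' i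
  have h2 := mem_cube.1 hy i
  rw [Real.dist_eq, abs_sub_lt_iff]
  simp only [dyadicIndex] at h1 h2
  constructor <;> linarith [h1.1, h1.2, h2.1, h2.2]

theorem volume_dyadicCube_succ {j : ℕ} (hh : 0 < h) (m m' : Fin n → ℤ) :
    volume (dyadicCube a h (j, m)) = 2 ^ n * volume (dyadicCube a h (j + 1, m')) := by
  rw [dyadicCube, dyadicCube, volume_cube, volume_cube, ← mul_pow]
  congr 1
  rw [show (2 : ℝ≥0∞) = ENNReal.ofReal 2 by simp, ← ENNReal.ofReal_mul (by norm_num)]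
  congr 1
  simp only [pow_succ]
  field_simp

end DyadicGeometry

/-! ### Stopping cubes and the sparse family they generate. -/

section Stopping

open Relation

variable {n : ℕ} {a : Fin n → ℝ} {h : ℝ} {U : ℕ × (Fin n → ℤ) → Set (Fin n → ℝ)}

/-- `P` is one of the maximal dyadic cubes strictly inside `Q` on which the density of `U Q`
exceeds `2 ^ (-(n + 1))`. -/
structure IsStoppingChild (a : Fin n → ℝ) (h : ℝ) (U : ℕ × (Fin n → ℤ) → Set (Fin n → ℝ))
    (Q P : ℕ × (Fin n → ℤ)) : Prop where
  lt : Q.1 < P.1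
  subset : dyadicCube a h P ⊆ dyadicCube a h Q
  dense : volume (dyadicCube a h P) < 2 ^ (n + 1) * volume (dyadicCube a h P ∩ U Q)
  maximal : ∀ R : ℕ × (Fin n → ℤ), Q.1 < R.1 → R.1 < P.1 → dyadicCube a h P ⊆ dyadicCube a h R →
    2 ^ (n + 1) * volume (dyadicCube a h R ∩ U Q) ≤ volume (dyadicCube a h R)

/-- The part of `Q` outside its stopping children. -/
def stoppingRest (a : Fin n → ℝ) (h : ℝ) (U : ℕ × (Fin n → ℤ) → Set (Fin n → ℝ))
    (Q : ℕ × (Fin n → ℤ)) : Set (Fin n → ℝ) :=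
  dyadicCube a h Q \ ⋃ P : {P // IsStoppingChild a h U Q P}, dyadicCube a h P

theorem measurableSet_dyadicCube (Q : ℕ × (Fin n → ℤ)) : MeasurableSet (dyadicCube a h Q) :=
  measurableSet_cube _ _

theorem measurableSet_stoppingRest (Q : ℕ × (Fin n → ℤ)) :
    MeasurableSet (stoppingRest a h U Q) :=
  (measurableSet_dyadicCube Q).diff (MeasurableSet.iUnion fun _ => measurableSet_dyadicCube _)

theorem stoppingRest_subset (Q : ℕ × (Fin n → ℤ)) :
    stoppingRest a h U Q ⊆ dyadicCube a h Q := sdiff_subset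

theorem volume_dyadicCube_ne_zero (hh : 0 < h) (Q : ℕ × (Fin n → ℤ)) :
    volume (dyadicCube a h Q) ≠ 0 := volume_cube_ne_zero _ (side_pos hh _)

theorem volume_dyadicCube_ne_top (Q : ℕ × (Fin n → ℤ)) :
    volume (dyadicCube a h Q) ≠ ⊤ := volume_cube_ne_top _ _

theorem dyadicCube_nonempty (hh : 0 < h) (Q : ℕ × (Fin n → ℤ)) :
    (dyadicCube a h Q).Nonempty :=
  nonempty_of_measure_ne_zero (volume_dyadicCube_ne_zero hh Q)

theorem IsStoppingChild.eq_of_mem (hh : 0 < h) {Q P P' : ℕ × (Fin n → ℤ)}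
    (hP : IsStoppingChild a h U Q P) (hP' : IsStoppingChild a h U Q P') {x : Fin n → ℝ}
    (hx : x ∈ dyadicCube a h P) (hx' : x ∈ dyadicCube a h P') : P = P' := by
  rcases lt_trichotomy P.1 P'.1 with hlt | heq | hlt
  · exact absurd hP.dense (not_lt.2 (hP'.maximal P hP.lt hlt
      (dyadicCube_subset_of_mem hh hlt.le hx hx')))
  · rw [mem_dyadicCube_iff hh] at hx hx'
    rw [← hx, ← hx', heq]
  · exact absurd hP'.dense (not_lt.2 (hP.maximal P' hP'.lt hlt
      (dyadicCube_subset_of_mem hh hlt.le hx' hx)))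

/-- Openness of `U Q` replaces Lebesgue differentiation: a small dyadic cube around the point lies
in `U Q` and has density one. The coarsest dense cube containing the point is the child. -/
theorem exists_isStoppingChild (hh : 0 < h) {Q : ℕ × (Fin n → ℤ)} (hU : IsOpen (U Q))
    {x : Fin n → ℝ} (hxQ : x ∈ dyadicCube a h Q) (hx : x ∈ U Q) :
    ∃ P, IsStoppingChild a h U Q P ∧ x ∈ dyadicCube a h P := by
  classical
  have hex : ∃ j, Q.1 < j ∧ volume (dyadicCube a h (dyadicIndex a h j x)) <
      2 ^ (n + 1) * volume (dyadicCube a h (dyadicIndex a h j x) ∩ U Q) := by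
    obtain ⟨j, hj, hsub⟩ := exists_dyadicCube_subset_of_isOpen (a := a) hh hU hx Q.1
    refine ⟨j, hj, ?_⟩
    rw [inter_eq_left.2 hsub]
    nth_rewrite 1 [← one_mul (volume _)]
    exact ENNReal.mul_lt_mul_left (volume_dyadicCube_ne_zero hh _) (volume_dyadicCube_ne_top _)
      (one_lt_pow₀ (by norm_num) (by omega))
  obtain ⟨h1, h2⟩ := Nat.find_spec hex
  refine ⟨dyadicIndex a h (Nat.find hex) x, ⟨h1, ?_, h2, ?_⟩, mem_dyadicCube_dyadicIndex hh _ x⟩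
  · exact dyadicCube_subset_of_mem hh h1.le hxQ (mem_dyadicCube_dyadicIndex hh _ x)
  · intro R hQR hRP hsub
    have hxR := hsub (mem_dyadicCube_dyadicIndex hh _ x)
    have := Nat.find_min hex (m := R.1) hRP
    rw [(mem_dyadicCube_iff hh).1 hxR] at this
    push Not at this
    exact this hQR

/-- The dyadic parent of the child has density at most 2^{-(n+1)} and volume 2^n times that of the
child, so the density in the child is at most 1/2. -/
theorem IsStoppingChild.exists_notMem (hh : 0 < h) {Q P : ℕ × (Fin n → ℤ)}
    (hUv : 2 ^ (n + 2) * volume (U Q) ≤ volume (dyadicCube a h Q))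
    (hP : IsStoppingChild a h U Q P) : ∃ y ∈ dyadicCube a h P, y ∉ U Q := by
  by_contra hcon
  push Not at hcon
  have hPU : dyadicCube a h P ∩ U Q = dyadicCube a h P := inter_eq_left.2 hcon
  obtain ⟨x, hx⟩ := dyadicCube_nonempty (a := a) hh P
  obtain ⟨j, hj⟩ : ∃ j, P.1 = j + 1 := ⟨P.1 - 1, by have := hP.lt; omega⟩
  set R := dyadicIndex a h j x with hR
  have hxR : x ∈ dyadicCube a h R := mem_dyadicCube_dyadicIndex hh j x
  have hPR : dyadicCube a h P ⊆ dyadicCube a h R :=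
    dyadicCube_subset_of_mem hh (by simp [hR, dyadicIndex, hj]) hxR hx
  have hvol : volume (dyadicCube a h R) = 2 ^ n * volume (dyadicCube a h P) := by
    have hPe : P = (j + 1, P.2) := by rw [← hj]
    rw [hPe]
    exact volume_dyadicCube_succ hh _ _
  have hlt : 2 ^ n * volume (dyadicCube a h P) < 2 ^ (n + 1) * volume (dyadicCube a h P) := by
    rw [pow_succ', mul_assoc, two_mul]
    exact ENNReal.lt_add_right
      (ENNReal.mul_ne_top (ENNReal.pow_ne_top ENNReal.ofNat_ne_top) (volume_dyadicCube_ne_top _))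
      (mul_ne_zero (pow_ne_zero _ two_ne_zero) (volume_dyadicCube_ne_zero hh _))
  refine absurd hlt (not_lt.2 ?_)
  rw [← hvol]
  -- The parent may be `Q` itself, which maximality does not cover; there the bound on |U Q| is used
  -- instead.
  rcases (show Q.1 ≤ j by have := hP.lt; omega).eq_or_lt with hQj | hQj
  · have hQR : Q = R := by
      rw [← (mem_dyadicCube_iff hh).1 (hP.subset hx), hQj]
    rw [← hQR]
    refine le_trans ?_ hUv
    gcongr
    · norm_num
    · omega
    · exact hcon
  · refine le_trans ?_ (hP.maximal R hQj (by simp [hR, dyadicIndex, hj]) hPR)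
    gcongr
    exact fun y hy => ⟨hPR hy, hcon y hy⟩

/-- The children are disjoint, and each has volume below 2^{n+1} times that of its part of `U Q`. -/
theorem tsum_volume_isStoppingChild_le (hh : 0 < h) {Q : ℕ × (Fin n → ℤ)} (hU : IsOpen (U Q))
    (hUv : 2 ^ (n + 2) * volume (U Q) ≤ volume (dyadicCube a h Q)) :
    2 * ∑' P : {P // IsStoppingChild a h U Q P}, volume (dyadicCube a h (P : ℕ × (Fin n → ℤ))) ≤
      volume (dyadicCube a h Q) := by
  calc 2 * ∑' P : {P // IsStoppingChild a h U Q P}, volume (dyadicCube a h P)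
      ≤ 2 * ∑' P : {P // IsStoppingChild a h U Q P},
          2 ^ (n + 1) * volume (dyadicCube a h P ∩ U Q) := by
        gcongr with P; exact P.2.dense.le
    _ = 2 ^ (n + 2) * volume (⋃ P : {P // IsStoppingChild a h U Q P},
          dyadicCube a h P ∩ U Q) := by
        rw [ENNReal.tsum_mul_left, ← mul_assoc, ← pow_succ', measure_iUnion]
        · intro P P' hne
          rw [Function.onFun, disjoint_left]
          rintro x ⟨hx, -⟩ ⟨hx', -⟩
          exact hne (Subtype.ext (P.2.eq_of_mem hh P'.2 hx hx'))
        · exact fun P => (measurableSet_dyadicCube _).inter hU.measurableSet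
    _ ≤ 2 ^ (n + 2) * volume (U Q) := by
        gcongr; exact iUnion_subset fun P => inter_subset_right
    _ ≤ _ := hUv

theorem volume_dyadicCube_le_two_mul_stoppingRest (hh : 0 < h) {Q : ℕ × (Fin n → ℤ)}
    (hU : IsOpen (U Q)) (hUv : 2 ^ (n + 2) * volume (U Q) ≤ volume (dyadicCube a h Q)) :
    volume (dyadicCube a h Q) ≤ 2 * volume (stoppingRest a h U Q) := by
  have h1 : volume (dyadicCube a h Q) ≤ volume (stoppingRest a h U Q) +
      ∑' P : {P // IsStoppingChild a h U Q P},
        volume (dyadicCube a h (P : ℕ × (Fin n → ℤ))) := by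
    refine (measure_mono ?_).trans ((measure_union_le _ _).trans
      (add_le_add_right (measure_iUnion_le _) _))
    rw [stoppingRest, sdiff_union_self]
    exact subset_union_left
  have h2 := tsum_volume_isStoppingChild_le hh hU hUv
  set s := ∑' P : {P // IsStoppingChild a h U Q P},
    volume (dyadicCube a h (P : ℕ × (Fin n → ℤ)))
  have h3 : volume (dyadicCube a h Q) + volume (dyadicCube a h Q) ≤
      2 * volume (stoppingRest a h U Q) + volume (dyadicCube a h Q) := by
    calc volume (dyadicCube a h Q) + volume (dyadicCube a h Q)
        ≤ (volume (stoppingRest a h U Q) + s) + (volume (stoppingRest a h U Q) + s) :=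
          add_le_add h1 h1
      _ = 2 * volume (stoppingRest a h U Q) + 2 * s := by ring
      _ ≤ _ := by gcongr
  exact ENNReal.le_of_add_le_add_right (volume_dyadicCube_ne_top Q) h3

theorem IsStoppingChild.le_of_reflTransGen {Q P : ℕ × (Fin n → ℤ)}
    (hQP : ReflTransGen (IsStoppingChild a h U) Q P) : Q.1 ≤ P.1 := by
  induction hQP with
  | refl => exact le_rfl
  | tail _ hc ih => exact ih.trans hc.lt.le

theorem IsStoppingChild.reflTransGen_through {Q P : ℕ × (Fin n → ℤ)}
    (hQP : ReflTransGen (IsStoppingChild a h U) Q P) {x : Fin n → ℝ} (hx : x ∈ dyadicCube a h P) :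
    ReflTransGen (fun R S => IsStoppingChild a h U R S ∧ x ∈ dyadicCube a h S) Q P := by
  induction hQP with
  | refl => exact ReflTransGen.refl
  | tail _ hc ih => exact (ih (hc.subset hx)).tail ⟨hc, hx⟩

theorem IsStoppingChild.notMem_stoppingRest {Q P : ℕ × (Fin n → ℤ)}
    (hP : IsStoppingChild a h U Q P) {x : Fin n → ℝ} (hx : x ∈ dyadicCube a h P) :
    x ∉ stoppingRest a h U Q :=
  fun hxQ => hxQ.2 (mem_iUnion.2 ⟨⟨P, hP⟩, hx⟩)

/-- For fixed x, a cube has at most one stopping child containing x. The selected cubes containing x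
thus form a chain, and x is removed from every cube that has a successor in it. -/
theorem disjoint_stoppingRest (hh : 0 < h) {Q₀ Q P : ℕ × (Fin n → ℤ)}
    (hQ : ReflTransGen (IsStoppingChild a h U) Q₀ Q)
    (hP : ReflTransGen (IsStoppingChild a h U) Q₀ P) (hne : Q ≠ P) :
    Disjoint (stoppingRest a h U Q) (stoppingRest a h U P) := by
  rw [disjoint_left]
  intro x hxQ hxP
  have hu : Relator.RightUnique
      (fun R S => IsStoppingChild a h U R S ∧ x ∈ dyadicCube a h S) :=
    fun _ _ _ h1 h2 => h1.1.eq_of_mem hh h2.1 h1.2 h2.2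
  rcases ReflTransGen.total_of_right_unique hu (IsStoppingChild.reflTransGen_through hQ hxQ.1)
    (IsStoppingChild.reflTransGen_through hP hxP.1) with hr | hr
  · rcases hr.cases_head with rfl | ⟨S, ⟨hS, hxS⟩, -⟩
    · exact hne rfl
    · exact hS.notMem_stoppingRest hxS hxQ
  · rcases hr.cases_head with rfl | ⟨S, ⟨hS, hxS⟩, -⟩
    · exact hne rfl
    · exact hS.notMem_stoppingRest hxS hxP

/-- Almost every point of a cube lies in only finitely many iterated stopping children. -/
theorem volume_diff_iUnion_stoppingRest (hh : 0 < h) (hU : ∀ Q, IsOpen (U Q))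
    (hUv : ∀ Q, 2 ^ (n + 2) * volume (U Q) ≤ volume (dyadicCube a h Q))
    (Q : ℕ × (Fin n → ℤ)) :
    volume (dyadicCube a h Q \ ⋃ S : {S // ReflTransGen (IsStoppingChild a h U) Q S},
      stoppingRest a h U S) = 0 := by
  set Z : ℕ × (Fin n → ℤ) → Set (Fin n → ℝ) := fun Q =>
    dyadicCube a h Q \ ⋃ S : {S // ReflTransGen (IsStoppingChild a h U) Q S},
      stoppingRest a h U S with hZ
  have hsub : ∀ Q, Z Q ⊆ ⋃ P : {P // IsStoppingChild a h U Q P}, Z P := by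
    rintro Q x ⟨hxQ, hx⟩
    simp only [mem_iUnion, not_exists] at hx
    have h1 : x ∉ stoppingRest a h U Q := hx ⟨Q, ReflTransGen.refl⟩
    have h2 : x ∈ ⋃ P : {P // IsStoppingChild a h U Q P}, dyadicCube a h P := by
      by_contra hcon; exact h1 ⟨hxQ, hcon⟩
    obtain ⟨P, hxP⟩ := mem_iUnion.1 h2
    refine mem_iUnion.2 ⟨P, hxP, ?_⟩
    simp only [mem_iUnion, not_exists]
    exact fun S => hx ⟨S, S.2.head P.2⟩
  -- The worst relative size of the exceptional set. That set is contained in those of the children,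
  -- which fill at most half of the cube, so θ ≤ θ/2 and θ = 0.
  set θ := ⨆ Q, volume (Z Q) / volume (dyadicCube a h Q) with hθ
  have hle : ∀ Q, volume (Z Q) ≤ θ * volume (dyadicCube a h Q) := fun Q => by
    rw [← ENNReal.div_le_iff (volume_dyadicCube_ne_zero hh Q) (volume_dyadicCube_ne_top Q)]
    exact le_iSup (fun Q => volume (Z Q) / volume (dyadicCube a h Q)) Q
  have hθ1 : θ ≤ 1 := iSup_le fun Q => ENNReal.div_le_of_le_mul (by
    rw [one_mul]; exact measure_mono sdiff_subset)
  have hθ2 : θ ≤ θ / 2 := by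
    refine iSup_le fun Q => ?_
    rw [ENNReal.div_le_iff (volume_dyadicCube_ne_zero hh Q) (volume_dyadicCube_ne_top Q)]
    calc volume (Z Q) ≤ ∑' P : {P // IsStoppingChild a h U Q P}, volume (Z P) :=
          (measure_mono (hsub Q)).trans (measure_iUnion_le _)
      _ ≤ ∑' P : {P // IsStoppingChild a h U Q P}, θ * volume (dyadicCube a h P) :=
          ENNReal.tsum_le_tsum fun P => hle P
      _ = θ / 2 * (2 * ∑' P : {P // IsStoppingChild a h U Q P}, volume (dyadicCube a h P)) := by
          rw [ENNReal.tsum_mul_left, ← mul_assoc, ENNReal.div_mul_cancel (by norm_num) (by norm_num)]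
      _ ≤ _ := by gcongr; exact tsum_volume_isStoppingChild_le hh (hU Q) (hUv Q)
  have hθ0 : θ = 0 := by
    by_contra h0
    exact absurd hθ2 (not_le.2 (ENNReal.half_lt_self h0 (ne_top_of_le_ne_top ENNReal.one_ne_top hθ1)))
  have := hle Q
  rw [hθ0, zero_mul] at this
  exact le_zero_iff.1 this

/-- Pointwise sparse domination obtained by iterating a one-step estimate along the stopping
cubes. -/
theorem ae_le_tsum_of_isStoppingChild (hh : 0 < h) (hU : ∀ Q, IsOpen (U Q))
    (hUv : ∀ Q, 2 ^ (n + 2) * volume (U Q) ≤ volume (dyadicCube a h Q))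
    (u : ℕ × (Fin n → ℤ) → (Fin n → ℝ) → ℝ≥0∞) (lam : ℕ × (Fin n → ℤ) → ℝ≥0∞)
    (hu : ∀ Q, ∀ᵐ x, x ∈ dyadicCube a h Q → x ∉ U Q → u Q x ≤ lam Q)
    (hstep : ∀ Q P, IsStoppingChild a h U Q P →
      ∀ᵐ x, x ∈ dyadicCube a h P → u Q x ≤ lam Q + u P x) (Q₀ : ℕ × (Fin n → ℤ)) :
    ∀ᵐ x, x ∈ dyadicCube a h Q₀ → u Q₀ x ≤
      ∑' Q : {Q // ReflTransGen (IsStoppingChild a h U) Q₀ Q},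
        (dyadicCube a h Q).indicator (fun _ => lam Q) x := by
  classical
  have hu' := ae_all_iff.2 hu
  have hstep' : ∀ᵐ x : Fin n → ℝ, ∀ Q P, IsStoppingChild a h U Q P → x ∈ dyadicCube a h P →
      u Q x ≤ lam Q + u P x := by
    refine ae_all_iff.2 fun Q => ae_all_iff.2 fun P => ?_
    by_cases hc : IsStoppingChild a h U Q P
    · filter_upwards [hstep Q P hc] with x hx _ using hx
    · exact ae_of_all _ fun x hc' => absurd hc' hc
  have hnull := measure_eq_zero_iff_ae_notMem.1 (volume_diff_iUnion_stoppingRest hh hU hUv Q₀)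
  filter_upwards [hu', hstep', hnull] with x hx1 hx2 hx3 hxQ
  have hx4 : x ∈ ⋃ S : {S // ReflTransGen (IsStoppingChild a h U) Q₀ S},
      stoppingRest a h U S := by
    by_contra hcon; exact hx3 ⟨hxQ, hcon⟩
  obtain ⟨⟨S, hS⟩, hxS⟩ := mem_iUnion.1 hx4
  simp only at hxS
  have hmain : ∀ Q, ReflTransGen (fun R S => IsStoppingChild a h U R S ∧ x ∈ dyadicCube a h S) Q S →
      u Q x ≤ ∑' P, {P | ReflTransGen (IsStoppingChild a h U) Q P}.indicator
        (fun P => (dyadicCube a h P).indicator (fun _ => lam P) x) P := by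
    intro Q hQ
    induction hQ using ReflTransGen.head_induction_on with
    -- A point left over by all children of `S` is outside `U S`, since the children cover `U S`
    -- within the cube.
    | refl =>
      have hxU : x ∉ U S := fun hcon => by
        obtain ⟨P, hP, hxP⟩ := exists_isStoppingChild hh (hU S) hxS.1 hcon
        exact hP.notMem_stoppingRest hxP hxS
      refine le_trans ?_ (ENNReal.le_tsum S)
      rw [indicator_of_mem (show S ∈ {P | _} from ReflTransGen.refl), indicator_of_mem hxS.1]
      exact hx1 S hxS.1 hxU
    | @head R P hRP hPS ih =>
      have hxP := hRP.2
      have hxR := hRP.1.subset hxP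
      refine (hx2 R P hRP.1 hxP).trans ((add_le_add_right ih _).trans ?_)
      rw [← tsum_ite_eq R (fun _ => lam R), ← ENNReal.tsum_add]
      refine ENNReal.tsum_le_tsum fun S' => ?_
      by_cases hS' : S' = R
      · subst hS'
        -- Generations strictly increase along children, so a cube is not a descendant of its own
        -- child and its term is not counted twice.
        have h1 : S' ∉ {P' | ReflTransGen (IsStoppingChild a h U) P P'} := fun hcon =>
          absurd (IsStoppingChild.le_of_reflTransGen hcon) (not_le.2 hRP.1.lt)
        rw [if_pos rfl, indicator_of_notMem h1, add_zero,
          indicator_of_mem (show S' ∈ {P | _} from ReflTransGen.refl), indicator_of_mem hxR]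
      · rw [if_neg hS', zero_add]
        exact indicator_le_indicator_of_subset
          (fun P' (hP' : ReflTransGen _ _ _) => hP'.head hRP.1) (fun _ => zero_le) S'
  refine (hmain Q₀ (IsStoppingChild.reflTransGen_through hS hxS.1)).trans_eq ?_
  rw [← tsum_subtype]
  rfl

end Stopping

/-! ### Weak type bounds and pointwise sparse domination. -/

section WeakType

variable {n : ℕ} {𝕜 : Type} [RCLike 𝕜]

/-- The infimum defining the weak norm is attained. The case ‖f‖ = 0 is separate because there the
norm cannot be divided out. -/
theorem IsWeakType.mul_measure_rpow_le {q : ℝ} {S : ((Fin n → ℝ) → 𝕜) → (Fin n → ℝ) → ℝ≥0∞}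
    (hS : IsWeakType q S) {f : (Fin n → ℝ) → 𝕜} (hf : MemLp f (ENNReal.ofReal q) volume)
    (t : ℝ≥0) :
    (t : ℝ≥0∞) * volume {x | (t : ℝ≥0∞) < S f x} ^ (1 / q) ≤
      weakNorm q S * eLpNorm f (ENNReal.ofReal q) volume := by
  by_contra hcon
  push Not at hcon
  rcases eq_or_ne (eLpNorm f (ENNReal.ofReal q) volume) 0 with h0 | h0
  · obtain ⟨A, hA, -⟩ := sInf_lt_iff.1 hS
    have := hA f hf t
    rw [h0, mul_zero] at hcon this
    exact absurd hcon (not_lt.2 this)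
  · rw [← ENNReal.lt_div_iff_mul_lt (Or.inl h0) (Or.inl hf.2.ne)] at hcon
    obtain ⟨A, hA, hlt⟩ := sInf_lt_iff.1 hcon
    rw [ENNReal.lt_div_iff_mul_lt (Or.inl h0) (Or.inl hf.2.ne)] at hlt
    exact absurd hlt (not_lt.2 (hA f hf t))

/-- At level `t₀` a weak type bound gives a superlevel set of small measure, also when both sides
of the bound vanish. -/
theorem mul_measure_lt_le_of_weak_bound {α : Type*} [MeasurableSpace α] {μ : Measure α} {q : ℝ}
    (hq : 1 ≤ q) {g : α → ℝ≥0∞} {D : ℝ≥0∞}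
    (hg : ∀ t : ℝ≥0, (t : ℝ≥0∞) * μ {x | (t : ℝ≥0∞) < g x} ^ (1 / q) ≤ D)
    {κ V : ℝ≥0∞} (hκ : 1 ≤ κ) {t₀ : ℝ≥0} (ht₀ : κ * D ≤ t₀ * V ^ (1 / q)) :
    κ * μ {x | (t₀ : ℝ≥0∞) < g x} ≤ V := by
  have hq0 : 0 < q := by linarith
  -- At level zero the hypothesis forces D = 0. All positive superlevel sets are then null, and {g >
  -- 0} is a countable union of them.
  rcases eq_or_ne t₀ 0 with rfl | h0
  · have hD0 : D = 0 := by
      simp only [ENNReal.coe_zero, zero_mul, nonpos_iff_eq_zero, mul_eq_zero] at ht₀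
      rcases ht₀ with h | h
      · exact absurd hκ (by simp [h])
      · exact h
    have hz : μ {x | ((0 : ℝ≥0) : ℝ≥0∞) < g x} = 0 := by
      have hsub : {x | ((0 : ℝ≥0) : ℝ≥0∞) < g x} ⊆
          ⋃ k : ℕ, {x | (((k : ℝ≥0) + 1)⁻¹ : ℝ≥0) < g x} := by
        intro x (hx : ((0 : ℝ≥0) : ℝ≥0∞) < g x)
        obtain ⟨k, hk⟩ := ENNReal.exists_inv_nat_lt hx.ne'
        refine mem_iUnion.2 ⟨k, lt_of_le_of_lt ?_ hk⟩
        rw [ENNReal.coe_inv (by positivity)]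
        gcongr
        push_cast
        exact le_self_add
      refine measure_mono_null hsub (measure_iUnion_null fun k => ?_)
      have := hg ((k : ℝ≥0) + 1)⁻¹
      rw [hD0, nonpos_iff_eq_zero, mul_eq_zero] at this
      rcases this with h | h
      · rw [ENNReal.coe_eq_zero, inv_eq_zero] at h
        exact absurd h (by positivity)
      · exact (ENNReal.rpow_eq_zero_iff_of_pos (by positivity)).1 h
    rw [hz, mul_zero]; exact zero_le
  · have ht0 : (t₀ : ℝ≥0∞) ≠ 0 := by simpa using h0
    have h1 : κ * μ {x | (t₀ : ℝ≥0∞) < g x} ^ (1 / q) ≤ V ^ (1 / q) := by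
      rw [← ENNReal.mul_le_mul_iff_right ht0 ENNReal.coe_ne_top]
      calc (t₀ : ℝ≥0∞) * (κ * μ {x | (t₀ : ℝ≥0∞) < g x} ^ (1 / q))
          = κ * (t₀ * μ {x | (t₀ : ℝ≥0∞) < g x} ^ (1 / q)) := by ring
        _ ≤ κ * D := by gcongr; exact hg t₀
        _ ≤ _ := ht₀
    have h2 := ENNReal.rpow_le_rpow h1 hq0.le
    rw [ENNReal.mul_rpow_of_nonneg _ _ hq0.le, ← ENNReal.rpow_mul, ← ENNReal.rpow_mul,
      one_div_mul_cancel hq0.ne', ENNReal.rpow_one, ENNReal.rpow_one] at h2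
    refine le_trans ?_ h2
    gcongr
    exact ENNReal.le_rpow_self_of_one_le hκ hq

theorem mem_sumLp_of_memLp_right {q r : ℝ} {f : (Fin n → ℝ) → 𝕜}
    (hf : MemLp f (ENNReal.ofReal r) volume) : f ∈ sumLp 𝕜 q r :=
  ⟨0, f, MemLp.zero, hf, by simp⟩

theorem mem_sumLp_of_memLp_left {q r : ℝ} {f : (Fin n → ℝ) → 𝕜}
    (hf : MemLp f (ENNReal.ofReal q) volume) : f ∈ sumLp 𝕜 q r :=
  ⟨f, 0, hf, MemLp.zero, by simp⟩

/-- The `L^r` average of `f` over the set `B`. -/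
noncomputable def rAverage (r : ℝ) (f : (Fin n → ℝ) → 𝕜) (B : Set (Fin n → ℝ)) : ℝ≥0∞ :=
  eLpNorm f (ENNReal.ofReal r) (volume.restrict B) * volume B ^ (-(1 / r))

theorem rAverage_ne_top {r : ℝ} {f : (Fin n → ℝ) → 𝕜}
    (hf : MemLp f (ENNReal.ofReal r) volume) {B : Set (Fin n → ℝ)} (hB0 : volume B ≠ 0)
    (hBt : volume B ≠ ⊤) : rAverage r f B ≠ ⊤ :=
  ENNReal.mul_ne_top (hf.restrict B).2.ne (by simp [ENNReal.rpow_eq_top_iff, hB0, hBt])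

theorem rAverage_rpow_mul {r : ℝ} (hr : 0 < r) (f : (Fin n → ℝ) → 𝕜) {B : Set (Fin n → ℝ)}
    (hB0 : volume B ≠ 0) (hBt : volume B ≠ ⊤) :
    rAverage r f B ^ r * volume B = ∫⁻ x in B, ‖f x‖ₑ ^ r := by
  have hr' : ENNReal.ofReal r ≠ 0 := by simpa using hr
  rw [rAverage, eLpNorm_eq_lintegral_rpow_enorm_toReal hr' ENNReal.ofReal_ne_top,
    ENNReal.toReal_ofReal hr.le, ENNReal.mul_rpow_of_nonneg _ _ hr.le, ← ENNReal.rpow_mul,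
    ← ENNReal.rpow_mul, one_div_mul_cancel hr.ne', neg_mul, one_div_mul_cancel hr.ne',
    ENNReal.rpow_one, ENNReal.rpow_neg_one, mul_assoc, ENNReal.inv_mul_cancel hB0 hBt, mul_one]

theorem eLpNorm_restrict_le_rAverage {q r : ℝ} (hq : 1 ≤ q) (hqr : q ≤ r) {f : (Fin n → ℝ) → 𝕜}
    (hf : AEStronglyMeasurable f volume) {B : Set (Fin n → ℝ)}
    (hB0 : volume B ≠ 0) (hBt : volume B ≠ ⊤) :
    eLpNorm f (ENNReal.ofReal q) (volume.restrict B) ≤ rAverage r f B * volume B ^ (1 / q) := by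
  have h := eLpNorm_le_eLpNorm_mul_rpow_measure_univ (μ := volume.restrict B)
    (ENNReal.ofReal_le_ofReal hqr) hf.restrict
  rw [ENNReal.toReal_ofReal (by linarith), ENNReal.toReal_ofReal (by linarith),
    Measure.restrict_apply_univ] at h
  refine h.trans_eq ?_
  rw [rAverage, mul_assoc, ← ENNReal.rpow_add _ _ hB0 hBt]
  congr 2
  ring

variable {a : Fin n → ℝ} {h : ℝ}

/-- Pointwise sparse domination of `T` on a cube. -/
theorem exists_sparse_domination {q r : ℝ} (hq : 1 ≤ q) (hqr : q ≤ r)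
    {T : ((Fin n → ℝ) → 𝕜) → ((Fin n → ℝ) → 𝕜)} (hT : IsSublinearOn volume (sumLp 𝕜 q r) T)
    (hTq : IsWeakType q (absOp T)) (hMr : IsWeakType r (grandMax T)) (hh : 0 < h)
    {f : (Fin n → ℝ) → 𝕜} (hf : MemLp f (ENNReal.ofReal r) volume) :
    ∃ U : ℕ × (Fin n → ℤ) → Set (Fin n → ℝ), (∀ Q, IsOpen (U Q)) ∧
      (∀ Q, 2 ^ (n + 2) * volume (U Q) ≤ volume (dyadicCube a h Q)) ∧
      ∀ᵐ x, x ∈ cube a h → ‖T ((tripleCube a h).indicator f) x‖ₑ ≤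
        ∑' Q : {Q // Relation.ReflTransGen (IsStoppingChild a h U) (0, 0) Q},
          (dyadicCube a h (Q : ℕ × (Fin n → ℤ))).indicator (fun _ =>
            2 ^ (n + 4) * 3 ^ n * (weakNorm q (absOp T) + weakNorm r (grandMax T)) *
              rAverage r f (dyadicTriple a h Q)) x := by
  have hr : 1 ≤ r := hq.trans hqr
  have hB0 : ∀ Q, volume (dyadicTriple a h Q) ≠ 0 := fun Q =>
    volume_tripleCube_ne_zero _ (side_pos hh _)
  have hBt : ∀ Q, volume (dyadicTriple a h Q) ≠ ⊤ := fun Q => volume_tripleCube_ne_top _ _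
  have hBm : ∀ Q, MeasurableSet (dyadicTriple a h Q) := fun Q => measurableSet_tripleCube _ _
  set Aq := weakNorm q (absOp T) with hAq
  set Ar := weakNorm r (grandMax T) with hAr
  set lam : ℕ × (Fin n → ℤ) → ℝ≥0∞ := fun Q => 2 ^ (n + 4) * 3 ^ n * (Aq + Ar) *
    rAverage r f (dyadicTriple a h Q) with hlam
  have hlamt : ∀ Q, lam Q ≠ ⊤ := fun Q => by
    refine ENNReal.mul_ne_top (ENNReal.mul_ne_top (ENNReal.mul_ne_top ?_ ?_)
      (ENNReal.add_ne_top.2 ⟨hTq.ne, hMr.ne⟩)) (rAverage_ne_top hf (hB0 Q) (hBt Q))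
    · exact ENNReal.pow_ne_top ENNReal.ofNat_ne_top
    · exact ENNReal.pow_ne_top ENNReal.ofNat_ne_top
  have hfr : ∀ Q, MemLp ((dyadicTriple a h Q).indicator f) (ENNReal.ofReal r) volume := fun Q =>
    hf.indicator (hBm Q)
  -- Hölder's inequality on 3Q; the factor 3^n bounds (|3Q|/|Q|)^{1/s}.
  have hind : ∀ {s : ℝ}, 1 ≤ s → s ≤ r → ∀ Q,
      eLpNorm ((dyadicTriple a h Q).indicator f) (ENNReal.ofReal s) volume ≤
        3 ^ n * rAverage r f (dyadicTriple a h Q) * volume (dyadicCube a h Q) ^ (1 / s) := by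
    intro s hs hsr Q
    rw [eLpNorm_indicator_eq_eLpNorm_restrict (hBm Q)]
    refine (eLpNorm_restrict_le_rAverage hs hsr hf.1 (hB0 Q) (hBt Q)).trans ?_
    rw [dyadicTriple, volume_tripleCube, ENNReal.mul_rpow_of_nonneg _ _ (by positivity),
      ← dyadicCube, ← dyadicTriple, mul_comm (3 ^ n : ℝ≥0∞), mul_assoc]
    gcongr
    nth_rewrite 2 [← ENNReal.rpow_one (3 ^ n)]
    refine ENNReal.rpow_le_rpow_of_exponent_le (one_le_pow₀ (by norm_num)) ?_
    rw [div_le_one (by linarith)]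
    exact hs
  have hfq : ∀ Q, MemLp ((dyadicTriple a h Q).indicator f) (ENNReal.ofReal q) volume := fun Q =>
    ⟨(hfr Q).1, lt_of_le_of_lt (hind hq hqr Q) (ENNReal.mul_lt_top (ENNReal.mul_lt_top
      (ENNReal.pow_lt_top (by simp)) (rAverage_ne_top hf (hB0 Q) (hBt Q)).lt_top)
      (ENNReal.rpow_lt_top_of_nonneg (by positivity) (volume_dyadicCube_ne_top Q)))⟩
  have hκ : (1 : ℝ≥0∞) ≤ 2 ^ (n + 4) := one_le_pow₀ (by norm_num)
  -- superlevel sets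
  have hlevel : ∀ {s : ℝ}, 1 ≤ s → s ≤ r →
      ∀ {S : ((Fin n → ℝ) → 𝕜) → (Fin n → ℝ) → ℝ≥0∞}, IsWeakType s S → weakNorm s S ≤ Aq + Ar →
      ∀ Q, MemLp ((dyadicTriple a h Q).indicator f) (ENNReal.ofReal s) volume →
      2 ^ (n + 4) * volume {x | lam Q < S ((dyadicTriple a h Q).indicator f) x} ≤
        volume (dyadicCube a h Q) := by
    intro s hs hsr S hS hSA Q hfs
    have key := mul_measure_lt_le_of_weak_bound hs
      (hS.mul_measure_rpow_le hfs) (V := volume (dyadicCube a h Q)) hκ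
      (t₀ := (lam Q).toNNReal) ?_
    · simpa only [ENNReal.coe_toNNReal (hlamt Q)] using key
    · rw [ENNReal.coe_toNNReal (hlamt Q)]
      calc 2 ^ (n + 4) * (weakNorm s S *
            eLpNorm ((dyadicTriple a h Q).indicator f) (ENNReal.ofReal s) volume)
          ≤ 2 ^ (n + 4) * ((Aq + Ar) * (3 ^ n * rAverage r f (dyadicTriple a h Q) *
            volume (dyadicCube a h Q) ^ (1 / s))) := by
            gcongr
            exact hind hs hsr Q
        _ = _ := by rw [hlam]; ring
  -- Both superlevel sets have measure at most 2^{-(n+4)}|Q|, so their union is strictly below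
  -- 2^{-(n+2)}|Q|. The slack pays for an open superset; outer regularity requires no measurability
  -- of M_T f.
  have hbad : ∀ Q, ∃ V : Set (Fin n → ℝ),
      {x | lam Q < absOp T ((dyadicTriple a h Q).indicator f) x} ∪
        {x | lam Q < grandMax T ((dyadicTriple a h Q).indicator f) x} ⊆ V ∧ IsOpen V ∧
      2 ^ (n + 2) * volume V ≤ volume (dyadicCube a h Q) := by
    intro Q
    have h1 := hlevel hq hqr hTq le_self_add Q (hfq Q)
    have h2 := hlevel hr le_rfl hMr le_add_self Q (hfr Q)
    have h3 : volume ({x | lam Q < absOp T ((dyadicTriple a h Q).indicator f) x} ∪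
        {x | lam Q < grandMax T ((dyadicTriple a h Q).indicator f) x}) <
        volume (dyadicCube a h Q) / 2 ^ (n + 2) := by
      have h4 : 2 ^ (n + 3) * volume ({x | lam Q < absOp T ((dyadicTriple a h Q).indicator f) x} ∪
          {x | lam Q < grandMax T ((dyadicTriple a h Q).indicator f) x}) ≤
          volume (dyadicCube a h Q) := by
        rw [← ENNReal.mul_le_mul_iff_right two_ne_zero ENNReal.ofNat_ne_top, ← mul_assoc,
          ← pow_succ']
        calc 2 ^ (n + 3 + 1) * volume ({x | lam Q < absOp T ((dyadicTriple a h Q).indicator f) x} ∪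
              {x | lam Q < grandMax T ((dyadicTriple a h Q).indicator f) x})
            ≤ 2 ^ (n + 3 + 1) * (volume _ + volume _) := by
              gcongr; exact measure_union_le _ _
          _ ≤ volume (dyadicCube a h Q) + volume (dyadicCube a h Q) := by
              rw [mul_add]; exact add_le_add h1 h2
          _ = _ := (two_mul _).symm
      rw [ENNReal.lt_div_iff_mul_lt (Or.inl (by positivity))
        (Or.inl (ENNReal.pow_ne_top ENNReal.ofNat_ne_top)), mul_comm]
      refine lt_of_not_ge fun hcon => ?_
      have h5 : 2 * volume (dyadicCube a h Q) ≤ volume (dyadicCube a h Q) := by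
        refine le_trans ?_ h4
        rw [pow_succ' 2 (n + 2), mul_assoc]
        gcongr
      rw [two_mul] at h5
      exact absurd h5 (not_le.2 (ENNReal.lt_add_right (volume_dyadicCube_ne_top Q)
        (volume_dyadicCube_ne_zero hh Q)))
    obtain ⟨V, hV, hVo, hVlt⟩ := Set.exists_isOpen_lt_of_lt _ _ h3
    refine ⟨V, hV, hVo, ?_⟩
    rw [mul_comm]
    exact (ENNReal.le_div_iff_mul_le (Or.inl (by positivity))
        (Or.inl (ENNReal.pow_ne_top ENNReal.ofNat_ne_top))).1 hVlt.le
  choose U hUsub hUo hUv using hbad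
  refine ⟨U, hUo, hUv, ?_⟩
  have hmain := ae_le_tsum_of_isStoppingChild hh hUo hUv
    (fun Q x => ‖T ((dyadicTriple a h Q).indicator f) x‖ₑ) lam ?_ ?_ (0, 0)
  · simpa only [dyadicCube_zero, dyadicTriple_zero] using hmain
  · refine fun Q => ae_of_all _ fun x _ hxU => ?_
    by_contra hcon
    exact hxU (hUsub Q (Or.inl (not_le.1 hcon)))
  · intro Q P hP
    -- One good point `y` in `P` suffices: the supremum defining M_T at `y` includes the cube `P`,
    -- so it controls almost all of `P`.
    obtain ⟨y, hyP, hyU⟩ := hP.exists_notMem hh (hUv Q)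
    have hM : grandMax T ((dyadicTriple a h Q).indicator f) y ≤ lam Q := by
      by_contra hcon
      exact hyU (hUsub Q (Or.inr (not_le.1 hcon)))
    have hess : essSup (fun ξ => ‖T ((dyadicTriple a h P)ᶜ.indicator
        ((dyadicTriple a h Q).indicator f)) ξ‖ₑ) (volume.restrict (dyadicCube a h P)) ≤ lam Q := by
      refine le_trans ?_ hM
      exact le_iSup_of_le (dyadicCorner a h P) (le_iSup_of_le (h / 2 ^ P.1)
        (le_iSup_of_le (side_pos hh _) (le_iSup_of_le hyP le_rfl)))
    have h1 := (ae_restrict_iff' (measurableSet_dyadicCube P)).1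
      (ENNReal.ae_le_essSup (μ := volume.restrict (dyadicCube a h P))
        (fun ξ => ‖T ((dyadicTriple a h P)ᶜ.indicator
        ((dyadicTriple a h Q).indicator f)) ξ‖ₑ))
    have hdec : (dyadicTriple a h Q).indicator f =
        (dyadicTriple a h P)ᶜ.indicator ((dyadicTriple a h Q).indicator f) +
          (dyadicTriple a h P).indicator f := by
      have hsub : dyadicTriple a h P ⊆ dyadicTriple a h Q :=
        tripleCube_subset_tripleCube (side_pos hh _) hP.subset
      ext x
      by_cases hxP : x ∈ dyadicTriple a h P
      · simp [hxP, hsub hxP]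
      · simp [hxP]
    have h2 := hT.norm_add_le _ (mem_sumLp_of_memLp_right ((hfr Q).indicator (hBm P).compl)) _
      (mem_sumLp_of_memLp_right (hfr P))
    filter_upwards [h1, h2] with x hx1 hx2 hxP
    rw [← hdec] at hx2
    calc ‖T ((dyadicTriple a h Q).indicator f) x‖ₑ
        ≤ ‖T ((dyadicTriple a h P)ᶜ.indicator ((dyadicTriple a h Q).indicator f)) x‖ₑ +
          ‖T ((dyadicTriple a h P).indicator f) x‖ₑ := by
          simp only [← ofReal_norm]
          rw [← ENNReal.ofReal_add (norm_nonneg _) (norm_nonneg _)]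
          exact ENNReal.ofReal_le_ofReal hx2
      _ ≤ _ := add_le_add_left ((hx1 hxP).trans hess) _

end WeakType

/-! ### The weighted estimate on one cube. -/

/-- Monotone convergence along finite subsets; it carries the bound for finite sparse sums over to
the whole stopping family. -/
theorem lintegral_tsum_rpow_le {α ι : Type*} [MeasurableSpace α] [Countable ι] {μ : Measure α}
    {p : ℝ} (hp : 0 < p) {g : ι → α → ℝ≥0∞} (hg : ∀ i, Measurable (g i)) {B : ℝ≥0∞}
    (hB : ∀ t : Finset ι, ∫⁻ x, (∑ i ∈ t, g i x) ^ p ∂μ ≤ B) :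
    ∫⁻ x, (∑' i, g i x) ^ p ∂μ ≤ B := by
  have h1 : ∀ x, (∑' i, g i x) ^ p = ⨆ t : Finset ι, (∑ i ∈ t, g i x) ^ p := fun x => by
    rw [ENNReal.tsum_eq_iSup_sum]
    exact (ENNReal.orderIsoRpow p hp).map_iSup _
  rw [lintegral_congr h1, lintegral_iSup_directed]
  · exact iSup_le hB
  · exact fun t => ((Finset.measurable_fun_sum _ fun i _ => hg i).pow_const _).aemeasurable
  · refine directed_of_isDirected_le fun s t hst x => ?_
    exact ENNReal.rpow_le_rpow (Finset.sum_le_sum_of_subset hst) hp.le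

section WeightedCube

variable {n : ℕ} {𝕜 : Type} [RCLike 𝕜]

/-- The constant in the weighted bound. -/
noncomputable def sparseConst (n : ℕ) (p r : ℝ) : ℝ≥0∞ :=
  2 ^ (n + 4) * 3 ^ n * ((2 * 3 ^ n) ^ (p / r * (max 1 (1 / (p - r)) - 1 / p)) *
    ((Fintype.card (Fin n → ZMod 3) : ℝ≥0∞) ^ (1 / p) *
      ENNReal.ofReal (p / r / (p / r - 1)) ^ (1 / r)) * ENNReal.ofReal p)

theorem sparseConst_ne_top {n : ℕ} {p r : ℝ} (hr : 1 ≤ r) (hrp : r < p) :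
    sparseConst n p r ≠ ⊤ := by
  have hβp : 0 ≤ max 1 (1 / (p - r)) - 1 / p := by
    have : 1 / p ≤ 1 / (p - r) := one_div_le_one_div_of_le (by linarith) (by linarith)
    linarith [le_max_right 1 (1 / (p - r))]
  have hp : 0 < p := by linarith
  have h2 : ∀ k : ℕ, (2 : ℝ≥0∞) ^ k ≠ ⊤ := fun k => ENNReal.pow_ne_top ENNReal.ofNat_ne_top
  have h3 : (3 : ℝ≥0∞) ^ n ≠ ⊤ := ENNReal.pow_ne_top ENNReal.ofNat_ne_top
  refine ENNReal.mul_ne_top (ENNReal.mul_ne_top (h2 _) h3) (ENNReal.mul_ne_top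
    (ENNReal.mul_ne_top (ENNReal.rpow_ne_top_of_nonneg (by positivity)
      (ENNReal.mul_ne_top ENNReal.ofNat_ne_top h3)) (ENNReal.mul_ne_top ?_ ?_))
      ENNReal.ofReal_ne_top)
  · exact ENNReal.rpow_ne_top_of_nonneg (by positivity) (ENNReal.natCast_ne_top _)
  · exact ENNReal.rpow_ne_top_of_nonneg (by positivity) ENNReal.ofReal_ne_top

/-- Combines sparse domination with the sparse bound. The constant does not involve the cube, so the
cube may later exhaust the space. -/
theorem setLIntegral_cube_rpow_le {p q r : ℝ} (hq : 1 ≤ q) (hqr : q ≤ r) (hrp : r < p)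
    {T : ((Fin n → ℝ) → 𝕜) → ((Fin n → ℝ) → 𝕜)} (hT : IsSublinearOn volume (sumLp 𝕜 q r) T)
    (hTq : IsWeakType q (absOp T)) (hMr : IsWeakType r (grandMax T))
    {W : (Fin n → ℝ) → ℝ≥0∞} (hW : Measurable W) (hW0 : ∀ x, W x ≠ 0) (hWt : ∀ x, W x ≠ ⊤)
    (hw : ∀ (a : Fin n → ℝ) (h : ℝ), 0 < h → volume.withDensity W (cube a h) ≠ ⊤)
    (hs : ∀ (a : Fin n → ℝ) (h : ℝ), 0 < h →
      volume.withDensity (fun x => W x ^ (-(1 / (p / r - 1)))) (cube a h) ≠ ⊤)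
    {K : ℝ≥0∞} (hK : K ≠ ⊤) (hap : ∀ (a : Fin n → ℝ) (h : ℝ), 0 < h →
      volume.withDensity W (cube a h) / volume (cube a h) *
        (volume.withDensity (fun x => W x ^ (-(1 / (p / r - 1)))) (cube a h) /
          volume (cube a h)) ^ (p / r - 1) ≤ K)
    {a : Fin n → ℝ} {h : ℝ} (hh : 0 < h) {f : (Fin n → ℝ) → 𝕜}
    (hf : MemLp f (ENNReal.ofReal r) volume) :
    ∫⁻ x in cube a h, ‖T ((tripleCube a h).indicator f) x‖ₑ ^ p ∂volume.withDensity W ≤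
      (sparseConst n p r * (weakNorm q (absOp T) + weakNorm r (grandMax T)) *
        K ^ max 1 (1 / (p - r))) ^ p * ∫⁻ x, ‖f x‖ₑ ^ p ∂volume.withDensity W := by
  classical
  have hr : 1 ≤ r := hq.trans hqr
  have hr0 : 0 < r := by linarith
  have hp0 : 0 < p := by linarith
  obtain ⟨U, hUo, hUv, hsparse⟩ := exists_sparse_domination hq hqr hT hTq hMr (a := a) hh hf
  set N := weakNorm q (absOp T) + weakNorm r (grandMax T) with hN
  set D := 2 ^ (n + 4) * 3 ^ n * N with hD
  have hB0 : ∀ Q, volume (dyadicTriple a h Q) ≠ 0 := fun Q =>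
    volume_tripleCube_ne_zero _ (side_pos hh _)
  have hBt : ∀ Q, volume (dyadicTriple a h Q) ≠ ⊤ := fun Q => volume_tripleCube_ne_top _ _
  have hside3 : ∀ j : ℕ, 0 < 3 * (h / 2 ^ j) := fun j => mul_pos (by norm_num) (side_pos hh j)
  have hrest : ∀ Q, volume (dyadicCube a h Q) ≤ 2 * volume (stoppingRest a h U Q) := fun Q =>
    volume_dyadicCube_le_two_mul_stoppingRest hh (hUo Q) (hUv Q)
  set lam : ℕ × (Fin n → ℤ) → ℝ≥0 := fun Q => (rAverage r f (dyadicTriple a h Q)).toNNReal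
  have hlam : ∀ Q, (lam Q : ℝ≥0∞) = rAverage r f (dyadicTriple a h Q) := fun Q =>
    ENNReal.coe_toNNReal (rAverage_ne_top hf (hB0 Q) (hBt Q))
  set w := volume.withDensity W with hwdef
  have hac : w ≪ volume := withDensity_absolutelyContinuous _ _
  have hfm : AEMeasurable (fun x => ‖f x‖ₑ) volume := hf.1.enorm
  set φ := hfm.mk with hφ
  have hφm : Measurable φ := hfm.measurable_mk
  have hφe : (fun x => ‖f x‖ₑ) =ᵐ[volume] φ := hfm.ae_eq_mk
  have hint : ∫⁻ x, ‖f x‖ₑ ^ p ∂w = ∫⁻ x, φ x ^ p ∂w :=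
    lintegral_congr_ae (by filter_upwards [hac.ae_le hφe] with x hx; rw [hx])
  set F := {Q // Relation.ReflTransGen (IsStoppingChild a h U) (0, 0) Q} with hF
  set CC := (2 * 3 ^ n) ^ (p / r * (max 1 (1 / (p - r)) - 1 / p)) * K ^ max 1 (1 / (p - r)) *
    ((Fintype.card (Fin n → ZMod 3) : ℝ≥0∞) ^ (1 / p) *
      ENNReal.ofReal (p / r / (p / r - 1)) ^ (1 / r)) * ENNReal.ofReal p with hCC
  have hfin : ∫⁻ x, (∑' Q : F, (dyadicCube a h Q.1).indicator (fun _ => (lam Q.1 : ℝ≥0∞)) x) ^ p ∂w ≤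
      CC ^ p * ∫⁻ x, φ x ^ p ∂w := by
    refine lintegral_tsum_rpow_le hp0
      (fun Q => measurable_const.indicator (measurableSet_dyadicCube _)) fun t => ?_
    refine lintegral_sparse_sum_rpow_le (κ := Fin n → ZMod 3) hr hrp t
      (fun Q => dyadicCube a h Q.1) (fun Q => dyadicTriple a h Q.1)
      (fun Q => stoppingRest a h U Q.1) (fun Q => dyadicColour Q.1)
      (fun Q _ => measurableSet_dyadicCube _) (fun Q _ => measurableSet_tripleCube _ _)
      (fun Q _ => measurableSet_stoppingRest _) (fun Q _ => stoppingRest_subset _)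
      (fun Q _ => cube_subset_tripleCube _ (side_pos hh _))
      (fun Q _ P _ => dyadicCube_laminar hh _ _)
      (fun Q _ P _ hc => dyadicTriple_laminar hh _ _ hc)
      (fun Q _ P _ hne => disjoint_stoppingRest hh Q.2 P.2 (fun h => hne (Subtype.ext h)))
      (ENNReal.mul_ne_top ENNReal.ofNat_ne_top (ENNReal.pow_ne_top ENNReal.ofNat_ne_top)) hK
      ?_ (fun Q _ => hBt _) ?_ hW hW0 hWt (fun Q _ => hw _ _ (hside3 _))
      (fun Q _ => hs _ _ (hside3 _)) (fun Q _ => hap _ _ (hside3 _)) hφm (fun Q => lam Q.1) ?_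
    · intro Q _ h0
      have := hrest Q.1
      rw [h0, mul_zero, nonpos_iff_eq_zero] at this
      exact volume_dyadicCube_ne_zero hh _ this
    -- Origin of M = 2·3^n: |3Q| = 3^n|Q| and |Q| ≤ 2|E_Q|.
    · intro Q _
      have h3 : volume (dyadicTriple a h Q.1) = 3 ^ n * volume (dyadicCube a h Q.1) :=
        volume_tripleCube _ _
      rw [h3, mul_comm (2 : ℝ≥0∞), mul_assoc]
      gcongr
      exact hrest _
    · intro Q _
      rw [hlam, rAverage_rpow_mul hr0 f (hB0 _) (hBt _)]
      refine (lintegral_congr_ae ?_).le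
      filter_upwards [ae_restrict_of_ae hφe] with x hx
      rw [hx]
  calc ∫⁻ x in cube a h, ‖T ((tripleCube a h).indicator f) x‖ₑ ^ p ∂w
      ≤ ∫⁻ x in cube a h, (D * ∑' Q : F,
          (dyadicCube a h Q.1).indicator (fun _ => (lam Q.1 : ℝ≥0∞)) x) ^ p ∂w := by
        refine lintegral_mono_ae ((ae_restrict_iff' (measurableSet_cube _ _)).2 ?_)
        filter_upwards [hac.ae_le hsparse] with x hx hxQ
        refine ENNReal.rpow_le_rpow ((hx hxQ).trans_eq ?_) hp0.le
        rw [← ENNReal.tsum_mul_left]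
        refine tsum_congr fun Q => ?_
        by_cases hxq : x ∈ dyadicCube a h Q.1 <;> simp [hxq, hlam]
    _ ≤ ∫⁻ x, (D * ∑' Q : F,
          (dyadicCube a h Q.1).indicator (fun _ => (lam Q.1 : ℝ≥0∞)) x) ^ p ∂w :=
        setLIntegral_le_lintegral _ _
    _ = D ^ p * ∫⁻ x, (∑' Q : F,
          (dyadicCube a h Q.1).indicator (fun _ => (lam Q.1 : ℝ≥0∞)) x) ^ p ∂w := by
        simp only [ENNReal.mul_rpow_of_nonneg _ _ hp0.le]
        refine lintegral_const_mul _ (Measurable.pow_const ?_ _)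
        exact Measurable.tsum fun Q => measurable_const.indicator (measurableSet_dyadicCube _)
    _ ≤ D ^ p * (CC ^ p * ∫⁻ x, φ x ^ p ∂w) := by gcongr
    _ = _ := by
        rw [← mul_assoc, ← ENNReal.mul_rpow_of_nonneg _ _ hp0.le, hint, hD, hCC, sparseConst]
        ring_nf

end WeightedCube

/-! ### Exhausting cubes and the structure of Muckenhoupt weights. -/

section Weights

variable {n : ℕ}

/-- An increasing sequence of cubes exhausting the space. -/
def exhaustingCorner (n k : ℕ) : Fin n → ℝ := fun _ => -(k + 1 : ℝ)

def exhaustingCube (n k : ℕ) : Set (Fin n → ℝ) :=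
  cube (exhaustingCorner n k) (2 * (k + 1))

def exhaustingTriple (n k : ℕ) : Set (Fin n → ℝ) :=
  tripleCube (exhaustingCorner n k) (2 * (k + 1))

theorem exhaustingSide_pos (k : ℕ) : (0 : ℝ) < 2 * (k + 1) := by positivity

theorem measurableSet_exhaustingCube (k : ℕ) : MeasurableSet (exhaustingCube n k) :=
  measurableSet_cube _ _

theorem measurableSet_exhaustingTriple (k : ℕ) : MeasurableSet (exhaustingTriple n k) :=
  measurableSet_tripleCube _ _

theorem volume_exhaustingCube_ne_top (k : ℕ) : volume (exhaustingCube n k) ≠ ⊤ :=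
  volume_cube_ne_top _ _

theorem mem_exhaustingCube {k : ℕ} {x : Fin n → ℝ} :
    x ∈ exhaustingCube n k ↔ ∀ i, -(k + 1 : ℝ) ≤ x i ∧ x i < k + 1 := by
  rw [exhaustingCube, mem_cube]
  refine forall_congr' fun i => ?_
  simp only [exhaustingCorner]
  constructor <;> rintro ⟨h1, h2⟩ <;> constructor <;> linarith

theorem exhaustingCube_mono {k l : ℕ} (hkl : k ≤ l) :
    exhaustingCube n k ⊆ exhaustingCube n l := by
  intro x hx
  have : (k : ℝ) ≤ l := by exact_mod_cast hkl
  rw [mem_exhaustingCube] at *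
  exact fun i => ⟨by linarith [(hx i).1], by linarith [(hx i).2]⟩

theorem exists_cube_subset_exhaustingCube (a : Fin n → ℝ) {h : ℝ} (hh : 0 < h) :
    ∃ k₀, ∀ k ≥ k₀, cube a h ⊆ exhaustingCube n k := by
  obtain ⟨k, hk⟩ := exists_nat_ge (‖a‖ + h)
  refine ⟨k, fun l hl x hx => ?_⟩
  have : (k : ℝ) ≤ l := by exact_mod_cast hl
  rw [mem_cube] at hx
  rw [mem_exhaustingCube]
  intro i
  have h1 := abs_le.1 ((Real.norm_eq_abs _).symm.le.trans (norm_le_pi_norm a i))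
  exact ⟨by linarith [(hx i).1, h1.1], by linarith [(hx i).2, h1.2]⟩

theorem exists_mem_exhaustingCube (x : Fin n → ℝ) : ∃ k₀, ∀ k ≥ k₀, x ∈ exhaustingCube n k := by
  obtain ⟨k₀, hk⟩ := exists_cube_subset_exhaustingCube x one_pos
  exact ⟨k₀, fun k hk' => hk k hk' (mem_cube.2 fun i => ⟨le_rfl, by linarith⟩)⟩

theorem iUnion_exhaustingCube : ⋃ k, exhaustingCube n k = univ :=
  eq_univ_of_forall fun x => by
    obtain ⟨k, hk⟩ := exists_mem_exhaustingCube x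
    exact mem_iUnion.2 ⟨k, hk k le_rfl⟩

theorem exhaustingCube_subset_triple (k : ℕ) : exhaustingCube n k ⊆ exhaustingTriple n k :=
  cube_subset_tripleCube _ (exhaustingSide_pos k)

theorem ae_of_ae_exhaustingCube {μ : Measure (Fin n → ℝ)} {P : (Fin n → ℝ) → Prop} {k₀ : ℕ}
    (h : ∀ k ≥ k₀, ∀ᵐ x ∂μ, x ∈ exhaustingCube n k → P x) : ∀ᵐ x ∂μ, P x := by
  have h' : ∀ᵐ x ∂μ, ∀ k ≥ k₀, x ∈ exhaustingCube n k → P x := by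
    refine ae_all_iff.2 fun k => ?_
    by_cases hk : k ≥ k₀
    · filter_upwards [h k hk] with x hx _ using hx
    · exact ae_of_all _ fun x hk' => absurd hk' hk
  filter_upwards [h'] with x hx
  obtain ⟨k₁, hk₁⟩ := exists_mem_exhaustingCube x
  exact hx (max k₀ k₁) (le_max_left _ _) (hk₁ _ (le_max_right _ _))

theorem IsWeight.lintegral_cube_lt_top {w : (Fin n → ℝ) → ℝ} (hw : IsWeight w) (a : Fin n → ℝ)
    (h : ℝ) : ∫⁻ x in cube a h, ENNReal.ofReal (w x) < ⊤ := by
  have hsub : cube a h ⊆ Icc a (fun i => a i + h) := fun x hx => by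
    rw [mem_cube] at hx
    exact ⟨fun i => (hx i).1, fun i => (hx i).2.le⟩
  have hint := (hw.locallyIntegrable.integrableOn_isCompact
    (isCompact_Icc (a := a) (b := fun i => a i + h))).mono_set hsub
  refine lt_of_le_of_lt (lintegral_mono fun x => ?_) hint.2
  rw [← ofReal_norm]
  exact ENNReal.ofReal_le_ofReal (le_abs_self _)

/-- A weight with finite `A_s` constant either vanishes almost everywhere, or it is positive and
its dual weight is locally integrable. -/
theorem IsWeight.eq_zero_or_exists_density {s : ℝ} (hs : 1 < s) {w : (Fin n → ℝ) → ℝ}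
    (hw : IsWeight w) (hK : apConst s w < ⊤) :
    weightMeasure w = 0 ∨ ∃ W : (Fin n → ℝ) → ℝ≥0∞, Measurable W ∧ (∀ x, W x ≠ 0) ∧
      (∀ x, W x ≠ ⊤) ∧ weightMeasure w = volume.withDensity W ∧
      (∀ (a : Fin n → ℝ) (h : ℝ), 0 < h → volume.withDensity W (cube a h) ≠ ⊤) ∧
      (∀ (a : Fin n → ℝ) (h : ℝ), 0 < h →
        volume.withDensity (fun x => W x ^ (-(1 / (s - 1)))) (cube a h) ≠ ⊤) ∧
      ∀ (a : Fin n → ℝ) (h : ℝ), 0 < h →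
        volume.withDensity W (cube a h) / volume (cube a h) *
        (volume.withDensity (fun x => W x ^ (-(1 / (s - 1)))) (cube a h) /
          volume (cube a h)) ^ (s - 1) ≤ apConst s w := by
  have hs1 : 0 < s - 1 := by linarith
  have hwm : AEMeasurable (fun x => ENNReal.ofReal (w x)) volume :=
    hw.locallyIntegrable.aestronglyMeasurable.aemeasurable.ennreal_ofReal
  have hle : ∀ (a : Fin n → ℝ) (h : ℝ), 0 < h →
      ((volume (cube a h))⁻¹ * ∫⁻ x in cube a h, ENNReal.ofReal (w x)) *
      ((volume (cube a h))⁻¹ *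
        ∫⁻ x in cube a h, ENNReal.ofReal (w x) ^ (-(1 / (s - 1)))) ^ (s - 1) ≤ apConst s w :=
    fun a h hh => le_iSup_of_le a (le_iSup_of_le h (le_iSup_of_le hh le_rfl))
  by_cases hzero : ∀ k, ∫⁻ x in exhaustingCube n k, ENNReal.ofReal (w x) = 0
  · left
    rw [← Measure.measure_univ_eq_zero, ← iUnion_exhaustingCube]
    refine measure_iUnion_null fun k => ?_
    rw [weightMeasure, withDensity_apply _ (measurableSet_exhaustingCube k)]
    exact hzero k
  right
  push Not at hzero
  obtain ⟨k₀, hk₀⟩ := hzero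
  -- The convention 0·∞ = 0 could hide an infinite dual integral only on cubes where w has no mass;
  -- beyond `k₀` there is mass.
  have hσk : ∀ k ≥ k₀, ∫⁻ x in exhaustingCube n k,
      ENNReal.ofReal (w x) ^ (-(1 / (s - 1))) ≠ ⊤ := by
    intro k hk htop
    have h1 := hle (exhaustingCorner n k) _ (exhaustingSide_pos k)
    rw [← exhaustingCube, htop, ENNReal.mul_top (ENNReal.inv_ne_zero.2 (volume_exhaustingCube_ne_top k)),
      ENNReal.top_rpow_of_pos hs1, ENNReal.mul_top] at h1
    · exact hK.ne (top_le_iff.1 h1)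
    · refine mul_ne_zero (ENNReal.inv_ne_zero.2 (volume_exhaustingCube_ne_top k)) fun h0 => hk₀ ?_
      exact le_zero_iff.1 (h0 ▸ lintegral_mono_set (exhaustingCube_mono hk))
  have hpos : ∀ᵐ x : Fin n → ℝ, ENNReal.ofReal (w x) ≠ 0 := by
    refine ae_of_ae_exhaustingCube (k₀ := k₀) fun k hk => ?_
    refine (ae_restrict_iff' (measurableSet_cube _ _)).1 ?_
    filter_upwards [ae_lt_top' (hwm.pow_const _).restrict (hσk k hk)] with x hx h0
    rw [h0, ENNReal.zero_rpow_of_neg (by simpa using hs1)] at hx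
    exact lt_irrefl _ hx
  classical
  set V := hwm.mk with hV
  have hVm : Measurable V := hwm.measurable_mk
  -- The value 1 is arbitrary: w is positive and finite almost everywhere, so it is used on a null
  -- set only.
  set W : (Fin n → ℝ) → ℝ≥0∞ := fun x => if V x = 0 ∨ V x = ⊤ then 1 else V x with hWdef
  have hWm : Measurable W := by
    refine Measurable.ite ?_ measurable_const hVm
    exact (hVm (measurableSet_singleton 0)).union (hVm (measurableSet_singleton ⊤))
  have hWe : (fun x => ENNReal.ofReal (w x)) =ᵐ[volume] W := by
    filter_upwards [hwm.ae_eq_mk, hpos] with x hx hx0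
    rw [hWdef]
    simp only
    rw [if_neg, hx]
    rw [hV, ← hx, not_or]
    exact ⟨hx0, ENNReal.ofReal_ne_top⟩
  have hi1 : ∀ a h, volume.withDensity W (cube a h) =
      ∫⁻ x in cube a h, ENNReal.ofReal (w x) := fun a h => by
    rw [withDensity_apply _ (measurableSet_cube _ _)]
    exact lintegral_congr_ae (ae_restrict_of_ae hWe.symm)
  have hi2 : ∀ a h, volume.withDensity (fun x => W x ^ (-(1 / (s - 1)))) (cube a h) =
      ∫⁻ x in cube a h, ENNReal.ofReal (w x) ^ (-(1 / (s - 1))) := fun a h => by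
    rw [withDensity_apply _ (measurableSet_cube _ _)]
    refine lintegral_congr_ae (ae_restrict_of_ae ?_)
    filter_upwards [hWe] with x hx
    rw [hx]
  refine ⟨W, hWm, ?_, ?_, withDensity_congr_ae hWe, ?_, ?_, ?_⟩
  · intro x
    simp only [hWdef]
    split_ifs with hx
    · exact one_ne_zero
    · exact fun h => hx (Or.inl h)
  · intro x
    simp only [hWdef]
    split_ifs with hx
    · exact ENNReal.one_ne_top
    · exact fun h => hx (Or.inr h)
  · intro a h _
    rw [hi1]
    exact (hw.lintegral_cube_lt_top a h).ne
  · intro a h hh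
    rw [hi2]
    obtain ⟨k₁, hk₁⟩ := exists_cube_subset_exhaustingCube a hh
    exact ne_top_of_le_ne_top (hσk (max k₀ k₁) (le_max_left _ _))
      (lintegral_mono_set (hk₁ _ (le_max_right _ _)))
  · intro a h hh
    rw [hi1, hi2, div_eq_mul_inv, div_eq_mul_inv, mul_comm _ (volume (cube a h))⁻¹,
      mul_comm _ (volume (cube a h))⁻¹]
    exact hle a h hh

end Weights

/-! ### From truncations to arbitrary functions in the domain. -/

section Limits

open Filter Topology

variable {n : ℕ} {𝕜 : Type} [RCLike 𝕜]

theorem eLpNorm_ofReal_rpow {α E : Type*} [MeasurableSpace α] [NormedAddCommGroup E] {μ : Measure α}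
    {p : ℝ} (hp : 0 < p) (f : α → E) :
    eLpNorm f (ENNReal.ofReal p) μ ^ p = ∫⁻ x, ‖f x‖ₑ ^ p ∂μ := by
  rw [eLpNorm_eq_lintegral_rpow_enorm_toReal (by simpa using hp) ENNReal.ofReal_ne_top,
    ENNReal.toReal_ofReal hp.le, ← ENNReal.rpow_mul, one_div_mul_cancel hp.ne', ENNReal.rpow_one]

theorem tendsto_eLpNorm_indicator_compl_exhaustingTriple {μ : Measure (Fin n → ℝ)} {p : ℝ}
    (hp : 0 < p) {f : (Fin n → ℝ) → 𝕜} (hf : MemLp f (ENNReal.ofReal p) μ) :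
    Tendsto (fun k => eLpNorm ((exhaustingTriple n k)ᶜ.indicator f) (ENNReal.ofReal p) μ)
      atTop (𝓝 0) := by
  have h1 : Tendsto (fun k => ∫⁻ x, ‖(exhaustingTriple n k)ᶜ.indicator f x‖ₑ ^ p ∂μ)
      atTop (𝓝 (∫⁻ _, 0 ∂μ)) := by
    refine tendsto_lintegral_of_dominated_convergence' (fun x => ‖f x‖ₑ ^ p) (fun k => ?_)
      (fun k => ae_of_all _ fun x => ?_) ?_ (ae_of_all _ fun x => ?_)
    · exact ((hf.1.indicator (measurableSet_exhaustingTriple k).compl).enorm.pow_const _)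
    · refine ENNReal.rpow_le_rpow ?_ hp.le
      exact enorm_indicator_le_enorm_self _ _
    · rw [← eLpNorm_ofReal_rpow hp]
      exact ENNReal.rpow_ne_top_of_nonneg hp.le hf.2.ne
    · obtain ⟨k₀, hk₀⟩ := exists_mem_exhaustingCube x
      refine tendsto_const_nhds.congr' ?_
      filter_upwards [eventually_ge_atTop k₀] with k hk
      have : x ∉ (exhaustingTriple n k)ᶜ := fun h => h (exhaustingCube_subset_triple k (hk₀ k hk))
      rw [indicator_of_notMem this, enorm_zero, ENNReal.zero_rpow_of_pos hp]
  rw [lintegral_zero] at h1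
  have h2 := (ENNReal.continuous_rpow_const (y := 1 / p)).tendsto _ |>.comp h1
  rw [ENNReal.zero_rpow_of_pos (by positivity)] at h2
  refine h2.congr fun k => ?_
  simp only [Function.comp]
  rw [← eLpNorm_ofReal_rpow hp, ← ENNReal.rpow_mul, mul_one_div_cancel hp.ne', ENNReal.rpow_one]

/-- Functions in `L^p(w)` are locally in `L^r` if the dual weight is locally integrable. -/
theorem MemLp.indicator_of_weight {p r : ℝ} (hr : 1 ≤ r) (hrp : r < p)
    {W : (Fin n → ℝ) → ℝ≥0∞} (hW : Measurable W) (hW0 : ∀ x, W x ≠ 0) (hWt : ∀ x, W x ≠ ⊤)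
    {B : Set (Fin n → ℝ)} (hBm : MeasurableSet B)
    (hB : volume.withDensity (fun x => W x ^ (-(1 / (p / r - 1)))) B ≠ ⊤)
    {f : (Fin n → ℝ) → 𝕜} (hf : MemLp f (ENNReal.ofReal p) (volume.withDensity W)) :
    MemLp (B.indicator f) (ENNReal.ofReal r) volume := by
  have hr0 : 0 < r := by linarith
  have hp0 : 0 < p := by linarith
  have hs : 1 < p / r := (one_lt_div hr0).2 hrp
  have hs1 : p / r - 1 ≠ 0 := by linarith
  have hss : (p / r).HolderConjugate (p / r / (p / r - 1)) := Real.HolderConjugate.conjExponent hs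
  have hac : volume ≪ volume.withDensity W :=
    withDensity_absolutelyContinuous' hW.aemeasurable (ae_of_all _ hW0)
  have hfm : AEStronglyMeasurable f volume := hf.1.mono_ac hac
  refine ⟨hfm.indicator hBm, ?_⟩
  have hlt : ∫⁻ x in B, ‖f x‖ₑ ^ r < ⊤ := by
    have h := ENNReal.lintegral_mul_le_Lp_mul_Lq (volume.restrict B) hss
      (f := fun x => ‖f x‖ₑ ^ r * W x ^ (r / p)) (g := fun x => W x ^ (-(r / p)))
      ((hfm.enorm.pow_const _).mul (hW.pow_const _).aemeasurable).restrict
      (hW.pow_const _).aemeasurable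
    have h1 : ∀ x, ((fun x => ‖f x‖ₑ ^ r * W x ^ (r / p)) * fun x => W x ^ (-(r / p))) x =
        ‖f x‖ₑ ^ r := fun x => by
      simp only [Pi.mul_apply]
      rw [mul_assoc, ← ENNReal.rpow_add _ _ (hW0 x) (hWt x)]; simp
    simp only [h1] at h
    refine h.trans_lt (ENNReal.mul_lt_top ?_ ?_)
    · refine ENNReal.rpow_lt_top_of_nonneg (by positivity) ?_
      refine ne_top_of_le_ne_top ?_ (setLIntegral_le_lintegral _ _)
      have h2 : ∀ x, (‖f x‖ₑ ^ r * W x ^ (r / p)) ^ (p / r) = W x * ‖f x‖ₑ ^ p := fun x => by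
        rw [ENNReal.mul_rpow_of_nonneg _ _ (by positivity), ← ENNReal.rpow_mul, ← ENNReal.rpow_mul,
          show r * (p / r) = p by field_simp, show r / p * (p / r) = 1 by field_simp,
          ENNReal.rpow_one, mul_comm]
      simp only [h2]
      have h3 := lintegral_withDensity_eq_lintegral_mul₀ (μ := volume) hW.aemeasurable
        (hfm.enorm.pow_const p)
      simp only [Pi.mul_apply] at h3
      rw [← h3, ← eLpNorm_ofReal_rpow hp0]
      exact ENNReal.rpow_ne_top_of_nonneg hp0.le hf.2.ne
    · refine ENNReal.rpow_lt_top_of_nonneg hss.symm.one_div_nonneg ?_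
      rw [withDensity_apply _ hBm] at hB
      have h2 : ∀ x, (W x ^ (-(r / p))) ^ (p / r / (p / r - 1)) = W x ^ (-(1 / (p / r - 1))) :=
        fun x => by
          rw [← ENNReal.rpow_mul]
          congr 1
          rw [neg_mul, neg_inj, ← mul_div_assoc, show r / p * (p / r) = 1 by field_simp]
      simpa only [h2] using hB
  rw [eLpNorm_indicator_eq_eLpNorm_restrict hBm]
  by_contra hcon
  rw [not_lt, top_le_iff] at hcon
  rw [← eLpNorm_ofReal_rpow hr0, hcon, ENNReal.top_rpow_of_pos hr0] at hlt
  exact lt_irrefl _ hlt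

/-- The L^q tails tend to zero, and weak type turns this into convergence in measure. -/
theorem tendstoInMeasure_indicator_compl_of_isWeakType {q : ℝ} (hq : 1 ≤ q)
    {T : ((Fin n → ℝ) → 𝕜) → ((Fin n → ℝ) → 𝕜)} (hTq : IsWeakType q (absOp T))
    {g : (Fin n → ℝ) → 𝕜} (hg : MemLp g (ENNReal.ofReal q) volume) :
    TendstoInMeasure volume (fun k => T ((exhaustingTriple n k)ᶜ.indicator g)) atTop 0 := by
  have hq0 : 0 < q := by linarith
  intro ε hε
  obtain ⟨t, ht0, htε⟩ := ENNReal.lt_iff_exists_nnreal_btwn.1 hε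
  have ht0' : (t : ℝ≥0∞) ≠ 0 := ht0.ne'
  have hlim := tendsto_eLpNorm_indicator_compl_exhaustingTriple (n := n) hq0 hg
  have h1 : Tendsto (fun k => (weakNorm q (absOp T) *
      eLpNorm ((exhaustingTriple n k)ᶜ.indicator g) (ENNReal.ofReal q) volume / t) ^ q)
      atTop (𝓝 0) := by
    have h2 := ENNReal.Tendsto.div_const (ENNReal.Tendsto.const_mul hlim (Or.inr hTq.ne))
      (b := (t : ℝ≥0∞)) (Or.inr ht0')
    have h3 := ((ENNReal.continuous_rpow_const (y := q)).tendsto _).comp h2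
    simpa [Function.comp_def, hq0] using h3
  refine tendsto_of_tendsto_of_tendsto_of_le_of_le tendsto_const_nhds h1 (fun _ => zero_le)
    fun k => ?_
  have h4 := hTq.mul_measure_rpow_le (hg.indicator (measurableSet_exhaustingTriple k).compl) t
  have h5 : volume {x | (t : ℝ≥0∞) < absOp T ((exhaustingTriple n k)ᶜ.indicator g) x} ^ (1 / q) ≤
      weakNorm q (absOp T) *
        eLpNorm ((exhaustingTriple n k)ᶜ.indicator g) (ENNReal.ofReal q) volume / t := by
    rw [ENNReal.le_div_iff_mul_le (Or.inl ht0') (Or.inl ENNReal.coe_ne_top), mul_comm]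
    exact h4
  have h6 := ENNReal.rpow_le_rpow h5 hq0.le
  rw [← ENNReal.rpow_mul, one_div_mul_cancel hq0.ne', ENNReal.rpow_one] at h6
  refine le_trans (measure_mono fun x (hx : ε ≤ _) => ?_) h6
  have hx' : ε ≤ ‖T ((exhaustingTriple n k)ᶜ.indicator g) x‖ₑ := by
    simpa [edist_zero_right] using hx
  exact htε.trans_le hx'

/-- M_T f is at least the essential supremum in question at every point of the cube Q_k. Weak type
therefore bounds it by a constant times |Q_k|^{-1/r}, which tends to zero because n ≥ 1. -/
theorem exists_tendsto_zero_of_isWeakType_grandMax (hn : 1 ≤ n) {r : ℝ} (hr : 1 ≤ r)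
    {T : ((Fin n → ℝ) → 𝕜) → ((Fin n → ℝ) → 𝕜)} (hMr : IsWeakType r (grandMax T))
    {f : (Fin n → ℝ) → 𝕜} (hf : MemLp f (ENNReal.ofReal r) volume) :
    ∃ e : ℕ → ℝ≥0∞, Tendsto e atTop (𝓝 0) ∧ ∀ k, ∀ᵐ x, x ∈ exhaustingCube n k →
      ‖T ((exhaustingTriple n k)ᶜ.indicator f) x‖ₑ ≤ e k := by
  have hr0 : 0 < r := by linarith
  set D := weakNorm r (grandMax T) * eLpNorm f (ENNReal.ofReal r) volume with hD
  have hDt : D ≠ ⊤ := ENNReal.mul_ne_top hMr.ne hf.2.ne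
  refine ⟨fun k => D / volume (exhaustingCube n k) ^ (1 / r), ?_, fun k => ?_⟩
  · have h1 : Tendsto (fun k => volume (exhaustingCube n k) ^ (1 / r)) atTop (𝓝 ⊤) := by
      have h0 : Tendsto (fun k : ℕ => (k : ℝ≥0∞) ^ (1 / r)) atTop (𝓝 ⊤) := by
        have := ((ENNReal.continuous_rpow_const (y := 1 / r)).tendsto ⊤).comp
          ENNReal.tendsto_nat_nhds_top
        rwa [ENNReal.top_rpow_of_pos (by positivity)] at this
      refine tendsto_of_tendsto_of_tendsto_of_le_of_le h0 tendsto_const_nhds (fun k => ?_)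
        fun _ => le_top
      refine ENNReal.rpow_le_rpow ?_ (by positivity)
      rw [exhaustingCube, volume_cube]
      have hk1 : (k : ℝ≥0∞) ≤ ENNReal.ofReal (2 * (k + 1)) := by
        rw [← ENNReal.ofReal_natCast]
        exact ENNReal.ofReal_le_ofReal (by have : (0 : ℝ) ≤ k := Nat.cast_nonneg k; linarith)
      have hk2 : (1 : ℝ≥0∞) ≤ ENNReal.ofReal (2 * (k + 1)) := by
        rw [← ENNReal.ofReal_one]
        exact ENNReal.ofReal_le_ofReal (by have : (0 : ℝ) ≤ k := Nat.cast_nonneg k; linarith)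
      exact hk1.trans (le_self_pow₀ hk2 (by omega))
    have h2 := ENNReal.Tendsto.const_div h1 (Or.inr hDt)
    rwa [ENNReal.div_top] at h2
  · have hV0 : volume (exhaustingCube n k) ≠ 0 := volume_cube_ne_zero _ (exhaustingSide_pos k)
    have hVt := volume_exhaustingCube_ne_top (n := n) k
    have hess : essSup (fun ξ => ‖T ((exhaustingTriple n k)ᶜ.indicator f) ξ‖ₑ)
        (volume.restrict (exhaustingCube n k)) ≤ D / volume (exhaustingCube n k) ^ (1 / r) := by
      refine ENNReal.le_of_forall_nnreal_lt fun t ht => ?_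
      rw [ENNReal.le_div_iff_mul_le (Or.inl (by simp [hV0, hVt]))
        (Or.inl (ENNReal.rpow_ne_top_of_nonneg (by positivity) hVt))]
      refine le_trans ?_ (hMr.mul_measure_rpow_le hf t)
      gcongr
      intro y hy
      refine lt_of_lt_of_le ht ?_
      exact le_iSup_of_le (exhaustingCorner n k) (le_iSup_of_le (2 * (k + 1))
        (le_iSup_of_le (exhaustingSide_pos k) (le_iSup_of_le hy le_rfl)))
    have h1 := (ae_restrict_iff' (measurableSet_exhaustingCube k)).1
      (ENNReal.ae_le_essSup (μ := volume.restrict (exhaustingCube n k))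
        (fun ξ => ‖T ((exhaustingTriple n k)ᶜ.indicator f) ξ‖ₑ))
    filter_upwards [h1] with x hx hxQ
    exact (hx hxQ).trans hess

theorem IsSublinearOn.enorm_add_le {μ : Measure (Fin n → ℝ)} {D : Set ((Fin n → ℝ) → 𝕜)}
    {T : ((Fin n → ℝ) → 𝕜) → ((Fin n → ℝ) → 𝕜)} (hT : IsSublinearOn μ D T)
    {f g : (Fin n → ℝ) → 𝕜} (hf : f ∈ D) (hg : g ∈ D) :
    ∀ᵐ x ∂μ, ‖T (f + g) x‖ₑ ≤ ‖T f x‖ₑ + ‖T g x‖ₑ := by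
  filter_upwards [hT.norm_add_le f hf g hg] with x hx
  simp only [← ofReal_norm]
  rw [← ENNReal.ofReal_add (norm_nonneg _) (norm_nonneg _)]
  exact ENNReal.ofReal_le_ofReal hx

/-- A uniform bound for truncations of `f` passes to `f`. -/
theorem eLpNorm_le_of_forall_truncation (hn : 1 ≤ n) {p q r : ℝ} (hq : 1 ≤ q) (hqr : q ≤ r)
    (hp : 0 < p) {T : ((Fin n → ℝ) → 𝕜) → ((Fin n → ℝ) → 𝕜)}
    (hT : IsSublinearOn volume (sumLp 𝕜 q r) T)
    (hTq : IsWeakType q (absOp T)) (hMr : IsWeakType r (grandMax T))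
    {w : Measure (Fin n → ℝ)} (hac : w ≪ volume) {f : (Fin n → ℝ) → 𝕜} (hf : f ∈ sumLp 𝕜 q r)
    (hfr : ∀ k, MemLp ((exhaustingTriple n k).indicator f) (ENNReal.ofReal r) volume)
    {C : ℝ≥0∞} (hC : ∀ k, ∫⁻ x in exhaustingCube n k,
      ‖T ((exhaustingTriple n k).indicator f) x‖ₑ ^ p ∂w ≤ C ^ p) :
    eLpNorm (T f) (ENNReal.ofReal p) w ≤ C := by
  have hr : 1 ≤ r := hq.trans hqr
  obtain ⟨g, h, hg, hh, rfl⟩ := hf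
  set f := g + h with hfdef
  have hTf := hT.aestronglyMeasurable f ⟨g, h, hg, hh, hfdef⟩
  obtain ⟨e, he, heb⟩ := exists_tendsto_zero_of_isWeakType_grandMax hn hr hMr hh
  obtain ⟨ns, hns, hlim⟩ :=
    (tendstoInMeasure_indicator_compl_of_isWeakType hq hTq hg).exists_seq_tendsto_ae
  -- The L^q part of the tail is handled by convergence in measure, the L^r part by the uniform
  -- bound `e k` on the cube.
  have hpt : ∀ k, ∀ᵐ x, x ∈ exhaustingCube n k → ‖T f x‖ₑ ≤
      ‖T ((exhaustingTriple n k).indicator f) x‖ₑ +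
        (‖T ((exhaustingTriple n k)ᶜ.indicator g) x‖ₑ + e k) := by
    intro k
    have hgc := hg.indicator (measurableSet_exhaustingTriple (n := n) k).compl
    have hhc := hh.indicator (measurableSet_exhaustingTriple (n := n) k).compl
    have h1 := hT.enorm_add_le (mem_sumLp_of_memLp_left hgc) (mem_sumLp_of_memLp_right hhc)
    have h2 := hT.enorm_add_le (mem_sumLp_of_memLp_right (hfr k))
      (g := (exhaustingTriple n k)ᶜ.indicator g + (exhaustingTriple n k)ᶜ.indicator h)
      ⟨_, _, hgc, hhc, rfl⟩
    have hdec : f = (exhaustingTriple n k).indicator f +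
        ((exhaustingTriple n k)ᶜ.indicator g + (exhaustingTriple n k)ᶜ.indicator h) := by
      rw [← indicator_add', ← hfdef, indicator_self_add_compl]
    rw [← hdec] at h2
    filter_upwards [h1, h2, heb k] with x hx1 hx2 hx3 hxQ
    exact hx2.trans (add_le_add le_rfl (hx1.trans (add_le_add le_rfl (hx3 hxQ))))
  set F : ℕ → (Fin n → ℝ) → ℝ≥0∞ := fun j => (exhaustingCube n (ns j)).indicator
    (fun x => ‖T ((exhaustingTriple n (ns j)).indicator f) x‖ₑ ^ p) with hF
  -- The errors δ vanish in the limit and each x lies in all large cubes, which prepares Fatou's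
  -- lemma.
  have hliminf : ∀ᵐ x ∂w, ‖T f x‖ₑ ^ p ≤ liminf (fun j => F j x) atTop := by
    filter_upwards [hac.ae_le (ae_all_iff.2 hpt), hac.ae_le hlim] with x hx hxlim
    set δ : ℕ → ℝ≥0∞ := fun j =>
      ‖T ((exhaustingTriple n (ns j))ᶜ.indicator g) x‖ₑ + e (ns j) with hδ
    have hδ0 : Tendsto δ atTop (𝓝 0) := by
      have := (hxlim.enorm).add (he.comp hns.tendsto_atTop)
      simpa using this
    have h1 : Tendsto (fun j => (‖T f x‖ₑ - δ j) ^ p) atTop (𝓝 (‖T f x‖ₑ ^ p)) := by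
      have := ENNReal.Tendsto.sub (tendsto_const_nhds (x := ‖T f x‖ₑ)) hδ0 (Or.inl enorm_ne_top)
      rw [tsub_zero] at this
      exact ((ENNReal.continuous_rpow_const (y := p)).tendsto _).comp this
    rw [← h1.liminf_eq]
    refine liminf_le_liminf ?_
    obtain ⟨k₀, hk₀⟩ := exists_mem_exhaustingCube x
    filter_upwards [eventually_ge_atTop k₀] with j hj
    have hxQ := hk₀ (ns j) (hj.trans (hns.id_le j))
    simp only [hF]
    rw [indicator_of_mem hxQ]
    refine ENNReal.rpow_le_rpow ?_ hp.le
    exact tsub_le_iff_right.2 (hx _ hxQ)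
  have hpow : ∫⁻ x, ‖T f x‖ₑ ^ p ∂w ≤ C ^ p := by
    refine (lintegral_mono_ae hliminf).trans ((lintegral_liminf_le' fun j => ?_).trans ?_)
    · refine AEMeasurable.indicator ?_ (measurableSet_exhaustingCube _)
      exact ((hT.aestronglyMeasurable _ (mem_sumLp_of_memLp_right (hfr _))).mono_ac hac).enorm.pow_const _
    · refine liminf_le_of_le (by isBoundedDefault) fun b hb => ?_
      obtain ⟨j, hj⟩ := hb.exists
      refine hj.trans ?_
      rw [hF, lintegral_indicator (measurableSet_exhaustingCube _)]
      exact hC _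
  rw [← eLpNorm_ofReal_rpow hp] at hpow
  exact (ENNReal.rpow_le_rpow_iff hp).1 hpow

end Limits

/-! ### Extension by continuity to the weighted space. -/

section Extension

open Filter Topology

theorem exists_memLp_tendsto_of_eLpNorm_sub_le {α E : Type*} [MeasurableSpace α]
    [NormedAddCommGroup E] [CompleteSpace E] {μ : Measure α} {p : ℝ≥0∞} (hp : 1 ≤ p)
    {u : ℕ → α → E} (hu : ∀ k, MemLp (u k) p μ) {b : ℕ → ℝ≥0∞} (hb : Tendsto b atTop (𝓝 0))
    (hub : ∀ k l, eLpNorm (u k - u l) p μ ≤ b k + b l) :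
    ∃ v, MemLp v p μ ∧ Tendsto (fun k => eLpNorm (u k - v) p μ) atTop (𝓝 0) := by
  have : Fact (1 ≤ p) := ⟨hp⟩
  have hc : CauchySeq fun k => (hu k).toLp (u k) := by
    refine EMetric.cauchySeq_iff.2 fun ε hε => ?_
    obtain ⟨N, hN⟩ := eventually_atTop.1 (hb.eventually (gt_mem_nhds (ENNReal.half_pos hε.ne')))
    refine ⟨N, fun m hm l hl => ?_⟩
    rw [Lp.edist_toLp_toLp]
    refine (hub m l).trans_lt ?_
    calc b m + b l < ε / 2 + ε / 2 := ENNReal.add_lt_add (hN m hm) (hN l hl)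
      _ = ε := ENNReal.add_halves ε
  obtain ⟨v, hv⟩ := cauchySeq_tendsto_of_complete hc
  refine ⟨v, Lp.memLp v, ?_⟩
  rw [← Lp.tendsto_Lp_iff_tendsto_eLpNorm'' u hu v (Lp.memLp v), Lp.toLp_coeFn]
  exact hv

/-- Passes pointwise relations to L^p limits. Three error terms are allowed because additivity
involves the limits for f, g and f + g. -/
theorem ae_le_of_tendsto_eLpNorm {α E : Type*} [MeasurableSpace α] [NormedAddCommGroup E]
    {μ : Measure α} {p : ℝ≥0∞} (hp : 1 ≤ p) {u v : α → ℝ} {d₁ d₂ d₃ : ℕ → α → E}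
    (hm₁ : ∀ k, AEStronglyMeasurable (d₁ k) μ) (hm₂ : ∀ k, AEStronglyMeasurable (d₂ k) μ)
    (hm₃ : ∀ k, AEStronglyMeasurable (d₃ k) μ)
    (h₁ : Tendsto (fun k => eLpNorm (d₁ k) p μ) atTop (𝓝 0))
    (h₂ : Tendsto (fun k => eLpNorm (d₂ k) p μ) atTop (𝓝 0))
    (h₃ : Tendsto (fun k => eLpNorm (d₃ k) p μ) atTop (𝓝 0))
    (h : ∀ k, ∀ᵐ x ∂μ, u x ≤ v x + (‖d₁ k x‖ + ‖d₂ k x‖ + ‖d₃ k x‖)) :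
    ∀ᵐ x ∂μ, u x ≤ v x := by
  set e : ℕ → α → ℝ := fun k => ((fun x => ‖d₁ k x‖) + fun x => ‖d₂ k x‖) + fun x => ‖d₃ k x‖
  have hem : ∀ k, AEStronglyMeasurable (e k) μ := fun k =>
    ((hm₁ k).norm.add (hm₂ k).norm).add (hm₃ k).norm
  have he : Tendsto (fun k => eLpNorm (e k - 0) p μ) atTop (𝓝 0) := by
    have hs : Tendsto (fun k => eLpNorm (d₁ k) p μ + eLpNorm (d₂ k) p μ + eLpNorm (d₃ k) p μ)
        atTop (𝓝 0) := by simpa using (h₁.add h₂).add h₃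
    refine tendsto_of_tendsto_of_tendsto_of_le_of_le tendsto_const_nhds hs (fun _ => zero_le)
      fun k => ?_
    rw [sub_zero]
    refine (eLpNorm_add_le ((hm₁ k).norm.add (hm₂ k).norm) (hm₃ k).norm hp).trans ?_
    rw [eLpNorm_norm]
    gcongr
    refine (eLpNorm_add_le (hm₁ k).norm (hm₂ k).norm hp).trans ?_
    rw [eLpNorm_norm, eLpNorm_norm]
  obtain ⟨ns, -, hlim⟩ := (tendstoInMeasure_of_tendsto_eLpNorm (zero_lt_one.trans_le hp).ne' hem
    aestronglyMeasurable_zero he).exists_seq_tendsto_ae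
  filter_upwards [ae_all_iff.2 h, hlim] with x hx hxl
  have h1 : Tendsto (fun j => v x + e (ns j) x) atTop (𝓝 (v x + 0)) := tendsto_const_nhds.add hxl
  rw [add_zero] at h1
  exact ge_of_tendsto h1 (Eventually.of_forall fun j => hx (ns j))

variable {n : ℕ} {𝕜 : Type} [RCLike 𝕜]

/-- A function-valued substitute for `|T|` whose increments are controlled by `T` of increments;
it is `T` itself in the linear case. -/
theorem IsSublinearOn.exists_increment_bound {μ : Measure (Fin n → ℝ)} {D : Set ((Fin n → ℝ) → 𝕜)}
    (hadd : ∀ f ∈ D, ∀ g ∈ D, f + g ∈ D) (hsmul : ∀ (c : 𝕜), ∀ f ∈ D, c • f ∈ D)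
    {T : ((Fin n → ℝ) → 𝕜) → ((Fin n → ℝ) → 𝕜)} (hT : IsSublinearOn μ D T) :
    ∃ N : ((Fin n → ℝ) → 𝕜) → ((Fin n → ℝ) → 𝕜),
      (∀ f ∈ D, AEStronglyMeasurable (N f) μ) ∧ (∀ f x, ‖N f x‖ = ‖T f x‖) ∧
      (∀ f ∈ D, ∀ g ∈ D, ∀ᵐ x ∂μ, ‖N f x - N g x‖ ≤ ‖T (f - g) x‖) ∧
      (IsLinearOn μ D T → ∀ f, N f = T f) := by
  classical
  have hsub : ∀ f ∈ D, ∀ g ∈ D, f - g ∈ D := fun f hf g hg => by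
    have := hadd f hf _ (hsmul (-1) g hg)
    rwa [neg_one_smul, ← sub_eq_add_neg] at this
  by_cases hlin : IsLinearOn μ D T
  · refine ⟨T, hT.aestronglyMeasurable, fun _ _ => rfl, fun f hf g hg => ?_, fun _ _ => rfl⟩
    have h1 := hlin.map_add (f - g) (hsub f hf g hg) g hg
    rw [sub_add_cancel] at h1
    filter_upwards [h1] with x hx
    rw [hx, Pi.add_apply, add_sub_cancel_right]
  -- Increments of a sublinear operator need not be controlled, but those of |T| are, by the reverse
  -- triangle inequality.
  · refine ⟨fun f x => ((‖T f x‖ : ℝ) : 𝕜), fun f hf => ?_, fun f x => ?_, fun f hf g hg => ?_,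
      fun h => absurd h hlin⟩
    · exact RCLike.continuous_ofReal.comp_aestronglyMeasurable (hT.aestronglyMeasurable f hf).norm
    · simp
    · have h1 := hT.norm_add_le (f - g) (hsub f hf g hg) g hg
      have h2 := hT.norm_add_le _ (hsmul (-1) _ (hsub f hf g hg)) f hf
      have h3 := hT.norm_smul (-1) _ (hsub f hf g hg)
      rw [sub_add_cancel] at h1
      rw [show (-1 : 𝕜) • (f - g) + f = g by rw [neg_one_smul]; abel] at h2
      filter_upwards [h1, h2, h3] with x hx1 hx2 hx3
      rw [norm_neg, norm_one, one_mul] at hx3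
      rw [← RCLike.ofReal_sub, RCLike.norm_ofReal, abs_le]
      constructor <;> linarith

/-- On the domain the substitute N for T is Lipschitz in L^p(ν). Truncations lie in the domain and
converge to f, so N extends by completeness, and the norm relations survive in the limit. -/
theorem IsSublinearOn.exists_extension {p : ℝ} (hp : 1 ≤ p) {μ ν : Measure (Fin n → ℝ)}
    (hνμ : ν ≪ μ) (hμν : μ ≪ ν) {D : Set ((Fin n → ℝ) → 𝕜)}
    (hadd : ∀ f ∈ D, ∀ g ∈ D, f + g ∈ D) (hsmul : ∀ (c : 𝕜), ∀ f ∈ D, c • f ∈ D)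
    (hae : ∀ f ∈ D, ∀ g, f =ᵐ[μ] g → g ∈ D)
    {T : ((Fin n → ℝ) → 𝕜) → ((Fin n → ℝ) → 𝕜)} (hT : IsSublinearOn μ D T)
    (htr : ∀ f, MemLp f (ENNReal.ofReal p) ν → ∀ k, (exhaustingTriple n k).indicator f ∈ D)
    {C : ℝ≥0∞} (hC : C ≠ ⊤) (hb : ∀ f ∈ D, MemLp f (ENNReal.ofReal p) ν →
      eLpNorm (T f) (ENNReal.ofReal p) ν ≤ C * eLpNorm f (ENNReal.ofReal p) ν) :
    ∃ U : ((Fin n → ℝ) → 𝕜) → ((Fin n → ℝ) → 𝕜),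
      IsSublinearOn ν {f | MemLp f (ENNReal.ofReal p) ν} U ∧
      (∀ f ∈ D, MemLp f (ENNReal.ofReal p) ν → U f =ᵐ[ν] T f) ∧
      (IsLinearOn μ D T → IsLinearOn ν {f | MemLp f (ENNReal.ofReal p) ν} U) ∧
      ∀ f : (Fin n → ℝ) → 𝕜, MemLp f (ENNReal.ofReal p) ν →
        eLpNorm (U f) (ENNReal.ofReal p) ν ≤ C * eLpNorm f (ENNReal.ofReal p) ν := by
  classical
  have hp0 : 0 < p := by linarith
  have hp1 : 1 ≤ ENNReal.ofReal p := by rwa [ENNReal.one_le_ofReal]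
  have hsub : ∀ f ∈ D, ∀ g ∈ D, f - g ∈ D := fun f hf g hg => by
    have := hadd f hf _ (hsmul (-1) g hg)
    rwa [neg_one_smul, ← sub_eq_add_neg] at this
  obtain ⟨N, hNm, hNT, hNsub, hNlin⟩ := hT.exists_increment_bound hadd hsmul
  set P := ENNReal.ofReal p with hP
  let tr : ℕ → ((Fin n → ℝ) → 𝕜) → ((Fin n → ℝ) → 𝕜) :=
    fun k f => (exhaustingTriple n k).indicator f
  have hD : ∀ {f}, MemLp f P ν → ∀ k, tr k f ∈ D := fun hf k => htr _ hf k
  have hL : ∀ {f}, MemLp f P ν → ∀ k, MemLp (tr k f) P ν := fun hf k =>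
    hf.indicator (measurableSet_exhaustingTriple k)
  have hNmem : ∀ {f}, f ∈ D → MemLp f P ν → MemLp (N f) P ν := fun {f} hf hfp => by
    refine ⟨(hNm f hf).mono_ac hνμ, ?_⟩
    rw [eLpNorm_congr_norm_ae (ae_of_all _ fun x => hNT f x)]
    exact (hb f hf hfp).trans_lt (ENNReal.mul_lt_top hC.lt_top hfp.2)
  have hNdiff : ∀ {f g}, f ∈ D → g ∈ D → MemLp f P ν → MemLp g P ν →
      eLpNorm (N f - N g) P ν ≤ C * eLpNorm (f - g) P ν := fun {f g} hf hg hfp hgp =>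
    (eLpNorm_mono_ae (hνμ.ae_le (hNsub f hf g hg))).trans (hb _ (hsub f hf g hg) (hfp.sub hgp))
  have htail : ∀ {f}, MemLp f P ν → Tendsto (fun k => eLpNorm (tr k f - f) P ν) atTop (𝓝 0) := by
    intro f hf
    refine (tendsto_eLpNorm_indicator_compl_exhaustingTriple hp0 hf).congr fun k => ?_
    rw [eLpNorm_sub_comm, indicator_compl]
  have hlim : ∀ f, ∃ v, MemLp f P ν → MemLp v P ν ∧
      Tendsto (fun k => eLpNorm (N (tr k f) - v) P ν) atTop (𝓝 0) := by
    intro f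
    by_cases hf : MemLp f P ν
    · have hb0 : Tendsto (fun k => C * eLpNorm (tr k f - f) P ν) atTop (𝓝 0) := by
        simpa using ENNReal.Tendsto.const_mul (htail hf) (Or.inr hC)
      obtain ⟨v, hv⟩ := exists_memLp_tendsto_of_eLpNorm_sub_le hp1
        (fun k => hNmem (hD hf k) (hL hf k)) hb0 fun k l => by
          refine (hNdiff (hD hf k) (hD hf l) (hL hf k) (hL hf l)).trans ?_
          rw [← mul_add]
          gcongr
          rw [← sub_sub_sub_cancel_right (tr k f) (tr l f) f]
          exact eLpNorm_sub_le ((hL hf k).sub hf).1 ((hL hf l).sub hf).1 hp1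
      exact ⟨v, fun _ => hv⟩
    · exact ⟨0, fun h => absurd h hf⟩
  choose L hLim using hlim
  have hdm : ∀ {f}, MemLp f P ν → ∀ k, AEStronglyMeasurable (N (tr k f) - L f) ν := fun hf k =>
    ((hNmem (hD hf k) (hL hf k)).sub (hLim _ hf).1).1
  have hz : Tendsto (fun _ : ℕ => eLpNorm (0 : (Fin n → ℝ) → 𝕜) P ν) atTop (𝓝 0) := by simp
  -- the limit agrees with `N` on the domain and respects almost everywhere equality
  have hLD : ∀ f ∈ D, MemLp f P ν → L f =ᵐ[ν] N f := by
    intro f hf hfp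
    have h0 := ae_le_of_tendsto_eLpNorm hp1 (u := fun x => ‖L f x - N f x‖) (v := fun _ => 0)
      (hdm hfp) (fun k => ((hNmem (hD hfp k) (hL hfp k)).sub (hNmem hf hfp)).1)
      (fun _ => aestronglyMeasurable_zero) (hLim f hfp).2
      (tendsto_of_tendsto_of_tendsto_of_le_of_le tendsto_const_nhds
        (by simpa using ENNReal.Tendsto.const_mul (htail hfp) (Or.inr hC)) (fun _ => zero_le)
        fun k => hNdiff (hD hfp k) hf (hL hfp k) hfp) hz
      (fun k => ae_of_all _ fun x => by
        simp only [Pi.sub_apply, Pi.zero_apply, norm_zero, add_zero, zero_add]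
        rw [norm_sub_rev (N _ x) (L f x)]
        exact norm_sub_le_norm_sub_add_norm_sub _ _ _)
    filter_upwards [h0] with x hx
    exact sub_eq_zero.1 (norm_le_zero_iff.1 hx)
  have hLcongr : ∀ f g, MemLp f P ν → MemLp g P ν → f =ᵐ[ν] g → L f =ᵐ[ν] L g := by
    intro f g hf hg hfg
    have hNe : ∀ k, N (tr k f) =ᵐ[ν] N (tr k g) := fun k => by
      have h1 := hNdiff (hD hf k) (hD hg k) (hL hf k) (hL hg k)
      have h2 : eLpNorm (tr k f - tr k g) P ν = 0 := by
        rw [eLpNorm_congr_ae (g := 0)]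
        · simp
        · filter_upwards [hfg] with x hx
          by_cases hxk : x ∈ exhaustingTriple n k <;> simp [tr, hxk, hx]
      rw [h2, mul_zero, nonpos_iff_eq_zero, eLpNorm_eq_zero_iff
        ((hNmem (hD hf k) (hL hf k)).sub (hNmem (hD hg k) (hL hg k))).1
        (zero_lt_one.trans_le hp1).ne'] at h1
      filter_upwards [h1] with x hx
      exact sub_eq_zero.1 hx
    have h0 := ae_le_of_tendsto_eLpNorm hp1 (u := fun x => ‖L f x - L g x‖) (v := fun _ => 0)
      (hdm hf) (hdm hg) (fun _ => aestronglyMeasurable_zero) (hLim f hf).2 (hLim g hg).2 hz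
      (fun k => by
        filter_upwards [hNe k] with x hx
        simp only [Pi.sub_apply, Pi.zero_apply, norm_zero, add_zero, zero_add]
        rw [hx, norm_sub_rev (N _ x) (L f x)]
        exact norm_sub_le_norm_sub_add_norm_sub _ _ _)
    filter_upwards [h0] with x hx
    exact sub_eq_zero.1 (norm_le_zero_iff.1 hx)
  have htradd : ∀ f g k, tr k (f + g) = tr k f + tr k g := fun f g k => indicator_add' _ _ _
  have htrsmul : ∀ (c : 𝕜) f k, tr k (c • f) = c • tr k f := fun c f k =>
    indicator_const_smul (exhaustingTriple n k) c f
  have hLadd : ∀ f g, MemLp f P ν → MemLp g P ν →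
      ∀ᵐ x ∂ν, ‖L (f + g) x‖ ≤ ‖L f x‖ + ‖L g x‖ := by
    intro f g hf hg
    refine ae_le_of_tendsto_eLpNorm hp1 (hdm (hf.add hg)) (hdm hf) (hdm hg)
      (hLim _ (hf.add hg)).2 (hLim f hf).2 (hLim g hg).2 fun k => ?_
    filter_upwards [hνμ.ae_le (hT.norm_add_le _ (hD hf k) _ (hD hg k))] with x hx
    rw [← htradd, ← hNT, ← hNT, ← hNT] at hx
    simp only [Pi.sub_apply]
    have h1 := norm_sub_norm_le (L (f + g) x) (N (tr k (f + g)) x)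
    have h2 := norm_sub_norm_le (N (tr k f) x) (L f x)
    have h3 := norm_sub_norm_le (N (tr k g) x) (L g x)
    rw [norm_sub_rev] at h1
    linarith
  have hdsmul : ∀ (c : 𝕜) {f}, MemLp f P ν →
      Tendsto (fun k => eLpNorm (c • (N (tr k f) - L f)) P ν) atTop (𝓝 0) := fun c f hf => by
    simp only [eLpNorm_const_smul]
    simpa using ENNReal.Tendsto.const_mul (hLim f hf).2 (Or.inr enorm_ne_top)
  have hLsmul : ∀ (c : 𝕜) f, MemLp f P ν → ∀ᵐ x ∂ν, ‖L (c • f) x‖ = ‖c‖ * ‖L f x‖ := by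
    intro c f hf
    have h0 := ae_le_of_tendsto_eLpNorm hp1
      (u := fun x => |‖L (c • f) x‖ - ‖c‖ * ‖L f x‖|) (v := fun _ => 0)
      (hdm (hf.const_smul c)) (fun k => (hdm hf k).const_smul c)
      (fun _ => aestronglyMeasurable_zero) (hLim _ (hf.const_smul c)).2 (hdsmul c hf) hz
      (fun k => by
        filter_upwards [hνμ.ae_le (hT.norm_smul c _ (hD hf k))] with x hx
        rw [← htrsmul, ← hNT, ← hNT] at hx
        simp only [Pi.sub_apply, Pi.zero_apply, Pi.smul_apply, norm_zero, add_zero, zero_add,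
          _root_.norm_smul]
        have h1 := abs_norm_sub_norm_le (N (tr k (c • f)) x) (L (c • f) x)
        have h2 := mul_le_mul_of_nonneg_left
          (abs_norm_sub_norm_le (N (tr k f) x) (L f x)) (norm_nonneg c)
        rw [← abs_norm c, ← abs_mul, mul_sub, abs_norm, ← hx] at h2
        rw [abs_le] at *
        constructor <;> linarith [h1.1, h1.2, h2.1, h2.2])
    filter_upwards [h0] with x hx
    exact sub_eq_zero.1 (abs_nonpos_iff.1 hx)
  have hLbound : ∀ f, MemLp f P ν → eLpNorm (L f) P ν ≤ C * eLpNorm f P ν := by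
    intro f hf
    have h1 : Tendsto (fun k => C * eLpNorm f P ν + eLpNorm (N (tr k f) - L f) P ν) atTop
        (𝓝 (C * eLpNorm f P ν + 0)) := tendsto_const_nhds.add (hLim f hf).2
    rw [add_zero] at h1
    refine ge_of_tendsto h1 (Eventually.of_forall fun k => ?_)
    have h2 := eLpNorm_sub_le (hNmem (hD hf k) (hL hf k)).1 (hdm hf k) hp1
    rw [sub_sub_cancel] at h2
    refine h2.trans (add_le_add_left ?_ _)
    rw [eLpNorm_congr_norm_ae (ae_of_all _ fun x => hNT _ x)]
    refine (hb _ (hD hf k) (hL hf k)).trans ?_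
    gcongr
    exact eLpNorm_indicator_le f
  -- Keeping `T` on the domain retains its values and phases there, while |U| = |L| almost
  -- everywhere on L^p(ν). The case distinction respects almost everywhere equality because `D`
  -- does.
  set U : ((Fin n → ℝ) → 𝕜) → ((Fin n → ℝ) → 𝕜) := fun f => if f ∈ D then T f else L f with hU
  have hUD : ∀ {f}, f ∈ D → U f = T f := fun hf => if_pos hf
  have hUL : ∀ {f}, f ∉ D → U f = L f := fun hf => if_neg hf
  have hUnorm : ∀ {f}, MemLp f P ν → ∀ᵐ x ∂ν, ‖U f x‖ = ‖L f x‖ := by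
    intro f hf
    by_cases hfD : f ∈ D
    · filter_upwards [hLD f hfD hf] with x hx
      rw [hUD hfD, hx, hNT]
    · exact ae_of_all _ fun x => by rw [hUL hfD]
  refine ⟨U, ⟨?_, ?_, ?_, ?_⟩, fun f hf _ => by rw [hUD hf], fun hlin => ?_, fun f hf => ?_⟩
  · intro f hf
    by_cases hfD : f ∈ D
    · rw [hUD hfD]; exact (hT.aestronglyMeasurable f hfD).mono_ac hνμ
    · rw [hUL hfD]; exact (hLim f hf).1.1
  · intro f hf g hg hfg
    have hfg' : f =ᵐ[μ] g := hμν.ae_le hfg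
    by_cases hfD : f ∈ D
    · have hgD := hae f hfD g hfg'
      rw [hUD hfD, hUD hgD]
      exact hνμ.ae_le (hT.congr_ae f hfD g hgD hfg')
    · have hgD : g ∉ D := fun h => hfD (hae g h f hfg'.symm)
      rw [hUL hfD, hUL hgD]
      exact hLcongr f g hf hg hfg
  · intro f hf g hg
    filter_upwards [hLadd f g hf hg, hUnorm hf, hUnorm hg, hUnorm (hf.add hg)] with x h1 h2 h3 h4
    rw [h2, h3, h4]
    exact h1
  · intro c f hf
    filter_upwards [hLsmul c f hf, hUnorm hf, hUnorm (hf.const_smul c)] with x h1 h2 h3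
    rw [h2, h3]
    exact h1
  · have hULin : ∀ {f}, MemLp f P ν → U f =ᵐ[ν] L f := fun {f} hf => by
      by_cases hfD : f ∈ D
      · filter_upwards [hLD f hfD hf] with x hx
        rw [hUD hfD, hx, hNlin hlin]
      · rw [hUL hfD]
    constructor
    · intro f hf g hg
      have h0 := ae_le_of_tendsto_eLpNorm hp1
        (u := fun x => ‖L (f + g) x - (L f x + L g x)‖) (v := fun _ => 0)
        (hdm (hf.add hg)) (hdm hf) (hdm hg) (hLim _ (hf.add hg)).2 (hLim f hf).2 (hLim g hg).2
        (fun k => by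
          filter_upwards [hνμ.ae_le (hlin.map_add _ (hD hf k) _ (hD hg k))] with x hx
          rw [← htradd, Pi.add_apply] at hx
          simp only [Pi.sub_apply, hNlin hlin, zero_add]
          rw [hx, norm_sub_rev (T (tr k f) x + T (tr k g) x)]
          calc ‖L (f + g) x - (L f x + L g x)‖
              = ‖(L (f + g) x - (T (tr k f) x + T (tr k g) x)) +
                (T (tr k f) x - L f x) + (T (tr k g) x - L g x)‖ := by congr 1; ring
            _ ≤ _ := norm_add₃_le)
      filter_upwards [h0, hULin hf, hULin hg, hULin (hf.add hg)] with x h1 h2 h3 h4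
      rw [Pi.add_apply, h2, h3, h4]
      exact sub_eq_zero.1 (norm_le_zero_iff.1 h1)
    · intro c f hf
      have h0 := ae_le_of_tendsto_eLpNorm hp1
        (u := fun x => ‖L (c • f) x - c * L f x‖) (v := fun _ => 0)
        (hdm (hf.const_smul c)) (fun k => (hdm hf k).const_smul c)
        (fun _ => aestronglyMeasurable_zero) (hLim _ (hf.const_smul c)).2 (hdsmul c hf) hz
        (fun k => by
          filter_upwards [hνμ.ae_le (hlin.map_smul c _ (hD hf k))] with x hx
          rw [← htrsmul, Pi.smul_apply, smul_eq_mul] at hx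
          simp only [Pi.sub_apply, Pi.zero_apply, Pi.smul_apply, norm_zero, add_zero, zero_add,
            hNlin hlin, smul_eq_mul]
          rw [hx, norm_sub_rev (c * _) (L (c • f) x), mul_sub]
          exact norm_sub_le_norm_sub_add_norm_sub _ _ _)
      filter_upwards [h0, hULin hf, hULin (hf.const_smul c)] with x h1 h2 h3
      rw [Pi.smul_apply, smul_eq_mul, h2, h3]
      exact sub_eq_zero.1 (norm_le_zero_iff.1 h1)
  · rw [eLpNorm_congr_norm_ae (hUnorm hf)]
    exact hLbound f hf

end Extension

/-! ### Closure properties of L^q + L^r. -/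

section Domain

variable {n : ℕ} {𝕜 : Type} [RCLike 𝕜] {q r : ℝ}

theorem add_mem_sumLp {f g : (Fin n → ℝ) → 𝕜} (hf : f ∈ sumLp 𝕜 q r) (hg : g ∈ sumLp 𝕜 q r) :
    f + g ∈ sumLp 𝕜 q r := by
  obtain ⟨f₁, f₂, h₁, h₂, rfl⟩ := hf
  obtain ⟨g₁, g₂, h₃, h₄, rfl⟩ := hg
  exact ⟨f₁ + g₁, f₂ + g₂, h₁.add h₃, h₂.add h₄, add_add_add_comm _ _ _ _⟩

theorem const_smul_mem_sumLp (c : 𝕜) {f : (Fin n → ℝ) → 𝕜} (hf : f ∈ sumLp 𝕜 q r) :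
    c • f ∈ sumLp 𝕜 q r := by
  obtain ⟨f₁, f₂, h₁, h₂, rfl⟩ := hf
  exact ⟨c • f₁, c • f₂, h₁.const_smul c, h₂.const_smul c, smul_add _ _ _⟩

theorem mem_sumLp_of_ae_eq {f g : (Fin n → ℝ) → 𝕜} (hf : f ∈ sumLp 𝕜 q r)
    (hfg : f =ᵐ[volume] g) : g ∈ sumLp 𝕜 q r := by
  obtain ⟨f₁, f₂, h₁, h₂, rfl⟩ := hf
  -- The change on a null set is absorbed by the first summand.
  refine ⟨g - f₂, f₂, h₁.ae_eq ?_, h₂, (sub_add_cancel _ _).symm⟩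
  filter_upwards [hfg] with x hx
  rw [Pi.sub_apply, ← hx, Pi.add_apply, add_sub_cancel_right]

end Domain

/-! ### The weighted bound and the extension. -/

theorem corollary4p6 (n : ℕ) (hn : 1 ≤ n) (p q r : ℝ) (hq : 1 ≤ q) (hqr : q ≤ r) (hrp : r < p) :
    ∃ c : ℝ≥0, ∀ (𝕜 : Type) [RCLike 𝕜] (T : ((Fin n → ℝ) → 𝕜) → ((Fin n → ℝ) → 𝕜)),
      IsSublinearOn volume (sumLp 𝕜 q r) T →
      IsWeakType q (absOp T) →
      IsWeakType r (grandMax T) →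
      ∀ w : (Fin n → ℝ) → ℝ, IsWeight w → apConst (p / r) w < ⊤ →
        -- the norm inequality on all functions of `L^p(w)` on which `T` is given
        (∀ f ∈ sumLp 𝕜 q r, MemLp f (ENNReal.ofReal p) (weightMeasure w) →
          eLpNorm (T f) (ENNReal.ofReal p) (weightMeasure w) ≤
            (c : ℝ≥0∞) * (weakNorm q (absOp T) + weakNorm r (grandMax T)) *
              apConst (p / r) w ^ max 1 (1 / (p - r)) *
              eLpNorm f (ENNReal.ofReal p) (weightMeasure w)) ∧
        -- the extension of `T` to the whole of `L^p(w)`, with the same bound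
        ∃ U : ((Fin n → ℝ) → 𝕜) → ((Fin n → ℝ) → 𝕜),
          IsSublinearOn (weightMeasure w)
            {f | MemLp f (ENNReal.ofReal p) (weightMeasure w)} U ∧
          (∀ f ∈ sumLp 𝕜 q r, MemLp f (ENNReal.ofReal p) (weightMeasure w) →
            U f =ᵐ[weightMeasure w] T f) ∧
          (IsLinearOn volume (sumLp 𝕜 q r) T →
            IsLinearOn (weightMeasure w)
              {f | MemLp f (ENNReal.ofReal p) (weightMeasure w)} U) ∧
          ∀ f : (Fin n → ℝ) → 𝕜, MemLp f (ENNReal.ofReal p) (weightMeasure w) →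
            eLpNorm (U f) (ENNReal.ofReal p) (weightMeasure w) ≤
              (c : ℝ≥0∞) * (weakNorm q (absOp T) + weakNorm r (grandMax T)) *
                apConst (p / r) w ^ max 1 (1 / (p - r)) *
                eLpNorm f (ENNReal.ofReal p) (weightMeasure w) := by
  have hr : 1 ≤ r := hq.trans hqr
  have hp0 : 0 < p := by linarith
  refine ⟨(sparseConst n p r).toNNReal, fun 𝕜 _ T hT hTq hMr w hw hK => ?_⟩
  rw [ENNReal.coe_toNNReal (sparseConst_ne_top hr hrp)]
  have hs : 1 < p / r := (one_lt_div (by linarith)).2 hrp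
  rcases hw.eq_zero_or_exists_density hs hK with h0 | ⟨W, hWm, hW0, hWt, hwW, hwc, hσc, hap⟩
  -- For the zero measure every claim is trivial, and `T` is its own extension.
  · rw [h0]
    refine ⟨fun f _ _ => by simp, T, ⟨fun f _ => aestronglyMeasurable_zero_measure _,
      fun f _ g _ _ => by simp [Filter.EventuallyEq], fun f _ g _ => by simp,
      fun c f _ => by simp⟩, fun f _ _ => by simp [Filter.EventuallyEq],
      fun _ => ⟨fun f _ g _ => by simp [Filter.EventuallyEq],
        fun c f _ => by simp [Filter.EventuallyEq]⟩, fun f _ => by simp⟩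
  rw [hwW]
  have hνμ : volume.withDensity W ≪ volume := withDensity_absolutelyContinuous _ _
  have hμν : volume ≪ volume.withDensity W :=
    withDensity_absolutelyContinuous' hWm.aemeasurable (ae_of_all _ hW0)
  have htr : ∀ f : (Fin n → ℝ) → 𝕜, MemLp f (ENNReal.ofReal p) (volume.withDensity W) → ∀ k,
      MemLp ((exhaustingTriple n k).indicator f) (ENNReal.ofReal r) volume := fun f hf k =>
    MemLp.indicator_of_weight hr hrp hWm hW0 hWt (measurableSet_exhaustingTriple k)
      (hσc _ _ (by have := exhaustingSide_pos k; linarith)) hf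
  set C := sparseConst n p r * (weakNorm q (absOp T) + weakNorm r (grandMax T)) *
    apConst (p / r) w ^ max 1 (1 / (p - r)) with hC
  have hCt : C ≠ ⊤ := ENNReal.mul_ne_top (ENNReal.mul_ne_top (sparseConst_ne_top hr hrp)
    (ENNReal.add_ne_top.2 ⟨hTq.ne, hMr.ne⟩))
    (ENNReal.rpow_ne_top_of_nonneg (zero_le_one.trans (le_max_left _ _)) hK.ne)
  have hb : ∀ f ∈ sumLp 𝕜 q r, MemLp f (ENNReal.ofReal p) (volume.withDensity W) →
      eLpNorm (T f) (ENNReal.ofReal p) (volume.withDensity W) ≤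
        C * eLpNorm f (ENNReal.ofReal p) (volume.withDensity W) := by
    intro f hf hfp
    refine eLpNorm_le_of_forall_truncation hn hq hqr hp0 hT hTq hMr hνμ hf (htr f hfp) fun k => ?_
    -- Applied to the truncation, which lies in L^r, unlike possibly f; truncating it again changes
    -- nothing.
    have h1 := setLIntegral_cube_rpow_le hq hqr hrp hT hTq hMr hWm hW0 hWt hwc hσc hK.ne hap
      (a := exhaustingCorner n k) (exhaustingSide_pos k) (htr f hfp k)
    rw [← exhaustingTriple, ← exhaustingCube, indicator_indicator, inter_self] at h1
    refine h1.trans ?_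
    rw [← hC, ENNReal.mul_rpow_of_nonneg C _ hp0.le, eLpNorm_ofReal_rpow hp0]
    gcongr with x
    exact enorm_indicator_le_enorm_self _ _
  exact ⟨hb, hT.exists_extension (by linarith) hνμ hμν
    (fun f hf g hg => add_mem_sumLp hf hg) (fun c f hf => const_smul_mem_sumLp c hf)
    (fun f hf g hfg => mem_sumLp_of_ae_eq hf hfg)
    (fun f hf k => mem_sumLp_of_memLp_right (htr f hf k)) hCt hb⟩
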